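/- Let $n,r\ge 1$ be integers and let $c_1,c_2$ be real constants with $1<c_1<c_2<\frac nr-1$ such that $c_1r$ and $c_2r$ are integers and $(c_2-c_1)r>1$. Let $A\in\mathbb R^{n\times n}$ be symmetric with eigendecomposition $A=V\Lambda V^T$, where $V=[V_1,V_2,V_3]$ is orthogonal, $\Lambda=\mathrm{diag}(\Lambda_1,\Lambda_2,\Lambda_3)$ is the diagonal matrix of the eigenvalues $\lambda_1(A),\dots,\lambda_n(A)$ ordered so that $|\lambda_1(A)|\ge\dots\ge|\lambda_n(A)|$, and the blocks with subscripts $1,2,3$ have $r$, $(c_1-1)r$ and $n-c_1r$ columns. Assume $\lambda_r(A)\neq0$. Write $\|\cdot\|_*$ for the nuclear norm (the sum of the singular values), $\|\cdot\|_F$ for the Frobenius norm, $M^\dagger$ for the Moore–Penrose pseudoinverse of $M$, and $A_r$ for a best rank-$r$ approximation of $A$, obtained from $A$ by truncating a singular value decomposition. Let $X\in\mathbb R^{n\times c_2r}$ be a random matrix whose entries are independent centred Gaussians with a common variance $v>0$, and put $X_i=V_i^TX$ for $i=1,2,3$. Let $Q_\perp\in\mathbb R^{c_2r\times(c_2-c_1+1)r}$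 have as its columns an orthonormal basis of the orthogonal complement of the column space of $X_2^T$ (such a $Q_\perp$ exists almost surely), and set $B=X_3Q_\perp(X_1Q_\perp)^\dagger\in\mathbb R^{(n-c_1r)\times r}$. Let $(X_1Q_\perp)^\dagger=\hat Q\hat R$ be a thin QR decomposition, and set $U=Q_\perp\hat Q\in\mathbb R^{c_2r\times r}$ and $P=UU^T$. Put $$E=A-AX(PX^TAXP)^\dagger X^TA,\qquad \Omega_F=\left\{\big\||\Lambda_3|^{1/2}B\big\|_F^2\le\tfrac12|\lambda_r(A)|\right\},$$ where $|\Lambda_3|$ is defined element-wise, and, with $b=\frac{r}{(c_2-c_1)r-1}$, $$\epsilon_{r,A}=2b\sqrt r\left(1+\frac{|\lambda_{c_1r+1}(A)|}{|\lambda_r(A)|}+\frac{2}{\sqrt b}\right)\frac{\|\Lambda_3\|_*}{\|\Lambda_2\|_*+\|\Lambda_3\|_*},$$ where the last fraction is read as $0$ if $\Lambda_2=0$ and $\Lambda_3=0$. Then, almost surely, $P$ is an orthogonal projector of rank $r$. Moreover $\Omega_F$ has positive probability, $\|E\|_*$ is integrable conditionally on $\Omega_F$, and $$\mathbb E\left[\|E\|_*\,\middle|\,\Omega_F\right]\le(1+\epsilon_{r,A})\,\|A-A_r\|_*.$$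 -/

import Mathlib

open MeasureTheory ProbabilityTheory Matrix
open scoped NNReal ENNReal

namespace Nystrom

/-- The four Penrose conditions: `G` is a Moore-Penrose inverse of the real matrix `M`. -/
structure IsMoorePenroseInverse {m n : Type*} [Fintype m] [Fintype n]
    (M : Matrix m n ℝ) (G : Matrix n m ℝ) : Prop where
  mul_mul_left : M * G * M = M
  mul_mul_right : G * M * G = G
  symm_left : (M * G)ᵀ = M * G
  symm_right : (G * M)ᵀ = G * M

theorem exists_isMoorePenroseInverse {m n : Type*} [Fintype m] [Fintype n]
    (M : Matrix m n ℝ) : ∃ G : Matrix n m ℝ, IsMoorePenroseInverse M G := by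
  classical
  have hS : (Mᵀ * M).IsHermitian := by
    simpa [conjTranspose_eq_transpose_of_trivial] using isHermitian_conjTranspose_mul_self M
  obtain ⟨W, d, hW, hd⟩ : ∃ (W : Matrix n n ℝ) (d : n → ℝ),
      Wᵀ * W = 1 ∧ Mᵀ * M = W * diagonal d * Wᵀ := by
    refine ⟨hS.eigenvectorUnitary, hS.eigenvalues, ?_, ?_⟩
    · have h := Unitary.coe_star_mul_self hS.eigenvectorUnitary
      rwa [star_eq_conjTranspose, conjTranspose_eq_transpose_of_trivial] at h
    · have h := hS.spectral_theorem
      rw [Unitary.conjStarAlgAut_apply] at h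
      rw [star_eq_conjTranspose, conjTranspose_eq_transpose_of_trivial] at h
      exact h
  set N : Matrix n n ℝ := W * diagonal (fun i => (d i)⁻¹) * Wᵀ with hN
  have key : ∀ e f : n → ℝ, (W * diagonal e * Wᵀ) * (W * diagonal f * Wᵀ)
      = W * diagonal (fun i => e i * f i) * Wᵀ := by
    intro e f
    calc (W * diagonal e * Wᵀ) * (W * diagonal f * Wᵀ)
        = W * diagonal e * (Wᵀ * W) * diagonal f * Wᵀ := by simp only [Matrix.mul_assoc]
      _ = _ := by rw [hW, Matrix.mul_one, Matrix.mul_assoc W, diagonal_mul_diagonal]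
  have hsymm : ∀ e : n → ℝ, (W * diagonal e * Wᵀ)ᵀ = W * diagonal e * Wᵀ := by
    intro e
    simp [Matrix.mul_assoc]
  have hNT : Nᵀ = N := hsymm _
  have hNMN : N * (Mᵀ * M) * N = N := by
    rw [hd, hN, key, key]
    congr 3
    funext i
    by_cases h : d i = 0 <;> simp [h]
  have hMNM : (Mᵀ * M) * N * (Mᵀ * M) = Mᵀ * M := by
    rw [hd, hN, key, key]
    congr 3
    funext i
    by_cases h : d i = 0 <;> simp [h]
  have hNM : (N * (Mᵀ * M))ᵀ = N * (Mᵀ * M) := by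
    rw [hd, hN, key]
    exact hsymm _
  have hA : M * N * (Mᵀ * M) = M := by
    have h0 : (M * N * (Mᵀ * M) - M)ᵀ * (M * N * (Mᵀ * M) - M) = 0 := by
      have h1 : (M * N * (Mᵀ * M) - M)ᵀ * (M * N * (Mᵀ * M) - M)
          = (Mᵀ * M) * N * ((Mᵀ * M) * N * (Mᵀ * M)) - (Mᵀ * M) * N * (Mᵀ * M)
            - ((Mᵀ * M) * N * (Mᵀ * M) - Mᵀ * M) := by
        simp only [transpose_sub, transpose_mul, transpose_transpose, hNT, Matrix.mul_sub,
          Matrix.sub_mul, Matrix.mul_assoc]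
      rw [h1, hMNM, hMNM]
      simp
    rw [← conjTranspose_eq_transpose_of_trivial, conjTranspose_mul_self_eq_zero] at h0
    exact sub_eq_zero.mp h0
  refine ⟨N * Mᵀ, ?_, ?_, ?_, ?_⟩
  · simpa only [Matrix.mul_assoc] using hA
  · calc N * Mᵀ * M * (N * Mᵀ) = N * (Mᵀ * M) * N * Mᵀ := by simp only [Matrix.mul_assoc]
      _ = _ := by rw [hNMN]
  · simp only [transpose_mul, transpose_transpose, hNT, Matrix.mul_assoc]
  · simpa only [Matrix.mul_assoc] using hNM

theorem IsMoorePenroseInverse.unique {m n : Type*} [Fintype m] [Fintype n]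
    {M : Matrix m n ℝ} {G H : Matrix n m ℝ}
    (hG : IsMoorePenroseInverse M G) (hH : IsMoorePenroseInverse M H) : G = H := by
  have h1 : M * G = M * H := by
    calc M * G = (M * H) * (M * G) := by
            rw [← Matrix.mul_assoc, hH.mul_mul_left]
      _ = ((M * G) * (M * H))ᵀ := by
            rw [transpose_mul, hH.symm_left, hG.symm_left]
      _ = M * H := by rw [← Matrix.mul_assoc, hG.mul_mul_left, hH.symm_left]
  have h2 : G * M = H * M := by
    calc G * M = (G * M) * (H * M) := by
            rw [Matrix.mul_assoc, ← Matrix.mul_assoc M, hH.mul_mul_left]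
      _ = ((H * M) * (G * M))ᵀ := by
            rw [transpose_mul, hH.symm_right, hG.symm_right]
      _ = H * M := by
            rw [Matrix.mul_assoc, ← Matrix.mul_assoc M, hG.mul_mul_left, hH.symm_right]
  calc G = G * M * G := hG.mul_mul_right.symm
    _ = H * M * H := by rw [h2, Matrix.mul_assoc, h1, ← Matrix.mul_assoc]
    _ = H := hH.mul_mul_right

/-- The (Moore-Penrose) pseudoinverse of a real matrix. -/
noncomputable def pinv {m n : Type*} [Fintype m] [Fintype n]
    (M : Matrix m n ℝ) : Matrix n m ℝ :=
  (exists_isMoorePenroseInverse M).choose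

theorem pinv_spec {m n : Type*} [Fintype m] [Fintype n] (M : Matrix m n ℝ) :
    IsMoorePenroseInverse M (pinv M) :=
  (exists_isMoorePenroseInverse M).choose_spec

/-- The nuclear norm: the sum of the singular values. -/
noncomputable def nuclearNorm {m n : Type*} [Fintype m] [Fintype n] [DecidableEq n]
    (M : Matrix m n ℝ) : ℝ :=
  (Matrix.toEuclideanLin M).singularValues.sum fun _ σ => σ

/-- The Frobenius norm. -/
noncomputable def frobeniusNorm {m n : Type*} [Fintype m] [Fintype n]
    (M : Matrix m n ℝ) : ℝ :=
  letI := Matrix.frobeniusSeminormedAddCommGroup (m := m) (n := n) (α := ℝ)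
  ‖M‖

/-- `A = V * diagonal l * Vᵀ` is an eigendecomposition of the real matrix `A` with `V` orthogonal
and the eigenvalues ordered in non-increasing order of magnitude. Thus `l i` is the
`(i+1)`-st largest eigenvalue of `A` in magnitude. -/
structure IsEigendecomposition {n : ℕ} (A V : Matrix (Fin n) (Fin n) ℝ) (l : Fin n → ℝ) :
    Prop where
  orthogonal : V ∈ Matrix.orthogonalGroup (Fin n) ℝ
  eq : A = V * Matrix.diagonal l * Vᵀ
  antitone : Antitone fun i => |l i|

/-- `Ar` is a best rank-`r` approximation of `A` in the sense of a truncated singular value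
decomposition: all but the `r` largest singular values in some singular value decomposition
of `A` are replaced by `0`. -/
def IsTruncatedSVD {n : ℕ} (A : Matrix (Fin n) (Fin n) ℝ) (r : ℕ)
    (Ar : Matrix (Fin n) (Fin n) ℝ) : Prop :=
  ∃ (Y Z : Matrix (Fin n) (Fin n) ℝ) (σ : Fin n → ℝ),
    Y ∈ Matrix.orthogonalGroup (Fin n) ℝ ∧ Z ∈ Matrix.orthogonalGroup (Fin n) ℝ ∧
    (∀ i, 0 ≤ σ i) ∧ Antitone σ ∧
    A = Y * Matrix.diagonal σ * Zᵀ ∧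
    Ar = Y * Matrix.diagonal (fun i : Fin n => if i.val < r then σ i else 0) * Zᵀ

/-- The embedding of `{0, …, k-1}` onto the consecutive indices `{a, …, a+k-1}` of
`{0, …, n-1}`. -/
def blockIdx {n : ℕ} (a k : ℕ) (h : a + k ≤ n) (i : Fin k) : Fin n :=
  ⟨a + i, by omega⟩

/-- The columns `a, …, a+k-1` (counted from `0`) of a matrix. -/
def colBlock {m : Type*} {n : ℕ} (V : Matrix m (Fin n) ℝ) (a k : ℕ) (h : a + k ≤ n) :
    Matrix m (Fin k) ℝ :=
  V.submatrix id (blockIdx a k h)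

/-- The diagonal block at positions `a, …, a+k-1` (counted from `0`) of `diagonal l`. -/
def diagBlock {n : ℕ} (l : Fin n → ℝ) (a k : ℕ) (h : a + k ≤ n) : Matrix (Fin k) (Fin k) ℝ :=
  (Matrix.diagonal l).submatrix (blockIdx a k h) (blockIdx a k h)

/-- The columns of `Q` are an orthonormal basis of the orthogonal complement of the column space
of `M`. -/
structure IsOrthonormalComplement {m k q : Type*} [Fintype m] [Fintype k] [Fintype q]
    [DecidableEq q] (M : Matrix m k ℝ) (Q : Matrix m q ℝ) : Prop where
  orthonormal : Qᵀ * Q = 1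
  range_eq : ∀ v : m → ℝ, Mᵀ *ᵥ v = 0 ↔ ∃ w : q → ℝ, Q *ᵥ w = v

/-- `M = Qh * Rh` is a thin QR decomposition: the columns of `Qh` are orthonormal and the
square matrix `Rh` is upper triangular. -/
structure IsThinQR {m : Type*} {r : ℕ} [Fintype m] (M Qh : Matrix m (Fin r) ℝ)
    (Rh : Matrix (Fin r) (Fin r) ℝ) : Prop where
  orthonormal : Qhᵀ * Qh = 1
  upper : ∀ i j, j < i → Rh i j = 0
  eq : M = Qh * Rh

/-- The entries of the random matrix `X` are independent centred Gaussians of common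
variance `v`. -/
structure IsGaussianMatrix {Ω : Type*} [MeasurableSpace Ω] {n s : ℕ}
    (X : Ω → Matrix (Fin n) (Fin s) ℝ) (v : ℝ≥0) (μ : Measure Ω) : Prop where
  hasLaw : ∀ i j, HasLaw (fun ω => X ω i j) (gaussianReal 0 v) μ
  indep : iIndepFun (fun (ij : Fin n × Fin s) ω => X ω ij.1 ij.2) μ

end Nystrom

open Nystrom

namespace Nystrom

/-! Rotating by `Vᵀ` turns `A` into `Λ = diagonal l` and leaves the law of the Gaussian matrix
unchanged. Let `N` consist of the first `p = c₁r` rows of `Vᵀ X`, that is of `X₁` over `X₂`. Almost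
surely `N` has full row rank, and then `Q⊥ (X₁ Q⊥)†` is the matrix `F` of the first `r` columns of
the pseudoinverse of `N` (`mul_pinv_eq_dualFrame`). Hence `K = Vᵀ X F` has the blocks `1, 0, B`. As
`U` and `F` have the same range, the pseudoinverse in `E` becomes an ordinary inverse and `E` is `Λ
- ΛK(KᵀΛK)⁻¹KᵀΛ` in the eigenbasis (`nystrom_error_eq`).

The rest of the pointwise argument is deterministic (`nuclearNorm_sketch_error_le`). The tail energy
`y = ‖|Λ₃|^(1/2) B‖_F²` bounds the perturbation `BᵀΛ₃B` of `Λ₁` in `KᵀΛK`. On the event `y ≤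
|λ_r|/2`, so `KᵀΛK` is invertible, its inverse has norm at most `2/|λ_r|`, and `Λ₁(KᵀΛK)⁻¹` has norm
at most `2`. In the expansion of `E` the block `Λ₁` cancels to leading order. Duality of the nuclear
norm with contractions and Cauchy-Schwarz for the trace bound what remains by `a + 2(1 + ρ)y +
4√(Ly)`, with `a = ‖Λ₂‖_* + ‖Λ₃‖_* = ‖A - A_r‖_*`, `L = ‖Λ₃‖_*` and `ρ = |λ_{p+1}|/|λ_r|`.

For the mean of `y`, condition on `N`: an entry of `B` in column `a` has second moment `v
((NNᵀ)⁻¹)_aa`. The inverse of `((NNᵀ)⁻¹)_aa` is the squared distance of row `a` from the span of the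
other rows, `v` times a `χ²` variable with `s - p + 1` degrees of freedom. So the mean of `y` is at
most `bL` (`lintegral_tailEnergy_le`). The event is a lower level set of `y`, so conditioning does
not raise this mean (`integral_cond_le_integral`). The inequality `4√(Ly) ≤ 2√b L + 2y/√b` makes the
bound affine in `y`; integrating it gives the claim, even without the factor `√r`. -/

/-- The squared Frobenius norm, as a sum of squares. -/
def sumSq {m n : Type*} [Fintype m] [Fintype n] (M : Matrix m n ℝ) : ℝ :=
  ∑ i, ∑ j, M i j ^ 2

/-- The matrix `W` is a contraction for the Euclidean norms. -/
def IsContraction {m n : Type*} [Fintype m] [Fintype n] (W : Matrix m n ℝ) : Prop :=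
  ∀ x : n → ℝ, W *ᵥ x ⬝ᵥ W *ᵥ x ≤ x ⬝ᵥ x

/-! ### Frobenius norms, contractions and traces. -/

section Norms

variable {m n k : Type*} [Fintype m] [Fintype n] [Fintype k]

theorem sumSq_nonneg (M : Matrix m n ℝ) : 0 ≤ sumSq M :=
  Finset.sum_nonneg fun _ _ => Finset.sum_nonneg fun _ _ => sq_nonneg _

theorem sumSq_transpose (M : Matrix m n ℝ) : sumSq Mᵀ = sumSq M := by
  unfold sumSq
  rw [Finset.sum_comm]
  rfl

theorem sumSq_eq_sum_col (M : Matrix m n ℝ) :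
    sumSq M = ∑ j, (fun i => M i j) ⬝ᵥ (fun i => M i j) := by
  unfold sumSq
  rw [Finset.sum_comm]
  simp [dotProduct, sq]

theorem frobeniusNorm_sq (M : Matrix m n ℝ) : frobeniusNorm M ^ 2 = sumSq M := by
  let _ := Matrix.frobeniusSeminormedAddCommGroup (m := m) (n := n) (α := ℝ)
  have h : frobeniusNorm M = (∑ i, ∑ j, ‖M i j‖ ^ (2 : ℝ)) ^ (1 / 2 : ℝ) :=
    Matrix.frobenius_norm_def M
  have h0 : 0 ≤ ∑ i, ∑ j, ‖M i j‖ ^ (2 : ℝ) :=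
    Finset.sum_nonneg fun _ _ => Finset.sum_nonneg fun _ _ => by positivity
  rw [h, ← Real.sqrt_eq_rpow, Real.sq_sqrt h0]
  simp [sumSq]

theorem sumSq_mul_le {W : Matrix m n ℝ} {c : ℝ}
    (hW : ∀ x : n → ℝ, W *ᵥ x ⬝ᵥ W *ᵥ x ≤ c * (x ⬝ᵥ x)) (M : Matrix n k ℝ) :
    sumSq (W * M) ≤ c * sumSq M := by
  rw [sumSq_eq_sum_col, sumSq_eq_sum_col, Finset.mul_sum]
  exact Finset.sum_le_sum fun j _ => hW fun i => M i j

theorem IsContraction.sumSq_mul_le {W : Matrix m n ℝ} (hW : IsContraction W) (M : Matrix n k ℝ) :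
    sumSq (W * M) ≤ sumSq M := by
  simpa using Nystrom.sumSq_mul_le (c := 1) (fun x => by rw [one_mul]; exact hW x) M

theorem trace_mul_le (P : Matrix m n ℝ) (Q : Matrix n m ℝ) :
    |(P * Q).trace| ≤ √(sumSq P) * √(sumSq Q) := by
  rw [← Real.sqrt_mul (sumSq_nonneg _), ← Real.sqrt_sq_eq_abs]
  apply Real.sqrt_le_sqrt
  have h : (P * Q).trace = ∑ x : m × n, P x.1 x.2 * Q x.2 x.1 := by
    simp [Matrix.trace, Matrix.mul_apply, Fintype.sum_prod_type]
  have hP : sumSq P = ∑ x : m × n, P x.1 x.2 ^ 2 := by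
    simp [sumSq, Fintype.sum_prod_type]
  have hQ : sumSq Q = ∑ x : m × n, Q x.2 x.1 ^ 2 := by
    rw [← sumSq_transpose]
    simp [sumSq, Fintype.sum_prod_type]
  rw [h, hP, hQ]
  exact Finset.sum_mul_sq_le_sq_mul_sq _ _ _

/-- With `W` taken from a polar decomposition, this bounds the nuclear norm of a product by the
product of the Frobenius norms. -/
theorem abs_trace_contraction_mul_le {W : Matrix m m ℝ} (hW : IsContraction W)
    (P : Matrix m n ℝ) (Q : Matrix n m ℝ) :
    |(W * (P * Q)).trace| ≤ √(sumSq P) * √(sumSq Q) := by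
  rw [← Matrix.mul_assoc]
  refine (trace_mul_le _ _).trans ?_
  gcongr
  exact hW.sumSq_mul_le P

theorem dotProduct_sq_le (x y : n → ℝ) : (x ⬝ᵥ y) ^ 2 ≤ (x ⬝ᵥ x) * (y ⬝ᵥ y) := by
  have := Finset.sum_mul_sq_le_sq_mul_sq Finset.univ x y
  simpa [dotProduct, sq] using this

/-- Cauchy-Schwarz gives `‖Wᵀx‖² = ⟨WWᵀx, x⟩ ≤ ‖WWᵀx‖ ‖x‖ ≤ ‖Wᵀx‖ ‖x‖`. -/
theorem IsContraction.transpose {W : Matrix m n ℝ} (hW : IsContraction W) : IsContraction Wᵀ := by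
  intro x
  have h1 : Wᵀ *ᵥ x ⬝ᵥ Wᵀ *ᵥ x = W *ᵥ (Wᵀ *ᵥ x) ⬝ᵥ x := by
    rw [dotProduct_comm, mulVec_transpose, ← dotProduct_mulVec, dotProduct_comm]
  have h2 := dotProduct_sq_le (W *ᵥ (Wᵀ *ᵥ x)) x
  have h3 := hW (Wᵀ *ᵥ x)
  have h4 : 0 ≤ x ⬝ᵥ x := by simpa using dotProduct_star_self_nonneg x
  have h5 : 0 ≤ Wᵀ *ᵥ x ⬝ᵥ Wᵀ *ᵥ x := by simpa using dotProduct_star_self_nonneg (Wᵀ *ᵥ x)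
  rw [← h1] at h2
  by_contra! hc
  nlinarith [mul_le_mul_of_nonneg_right h3 h4]

end Norms

/-! ### The nuclear norm: diagonalisations of the Gram matrix, trace duality, continuity. -/

section NuclearNorm

variable {m n : Type*} [Fintype m] [Fintype n] [DecidableEq n]

omit [Fintype n] [DecidableEq n] in
theorem isHermitian_gram (M : Matrix m n ℝ) : (Mᵀ * M).IsHermitian := by
  simpa [conjTranspose_eq_transpose_of_trivial] using isHermitian_conjTranspose_mul_self M

theorem nuclearNorm_eq_sum_eigenvalues [DecidableEq m] (M : Matrix m n ℝ) :
    nuclearNorm M = ∑ i, √((isHermitian_gram M).eigenvalues i) := by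
  have hS := isHermitian_gram M
  set T := Matrix.toEuclideanLin M with hT
  have hadj : LinearMap.adjoint T ∘ₗ T = Matrix.toEuclideanLin (Mᵀ * M) := by
    rw [hT, ← Matrix.toEuclideanLin_conjTranspose_eq_adjoint,
      conjTranspose_eq_transpose_of_trivial]
    ext x
    simp [Matrix.toLpLin_apply, Matrix.mulVec_mulVec]
  have h1 : nuclearNorm M = ∑ i : Fin (Fintype.card n), T.singularValues i := by
    unfold nuclearNorm
    rw [← hT, Finsupp.sum_of_support_subset (s := Finset.range (Fintype.card n))]
    · rw [Finset.sum_range]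
    · intro i hi
      rw [Finset.mem_range]
      by_contra! h
      exact (Finsupp.mem_support_iff.mp hi)
        (T.singularValues_of_finrank_le (by simpa using h))
    · simp
  have h2 : ∀ i : Fin (Fintype.card n), T.singularValues i = √(hS.eigenvalues₀ i) := by
    intro i
    rw [T.singularValues_fin finrank_euclideanSpace]
    congr 2
  rw [h1, Finset.sum_congr rfl fun i _ => h2 i]
  exact ((Fintype.equivOfCardEq (Fintype.card_fin _)).symm.sum_comp
    fun i => √(hS.eigenvalues₀ i)).symm

theorem roots_charpoly_conj_diagonal {Z : Matrix n n ℝ} (hZ : Zᵀ * Z = 1) (d : n → ℝ) :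
    (Z * diagonal d * Zᵀ).charpoly.roots = Finset.univ.val.map d := by
  rw [Matrix.charpoly_mul_comm, ← Matrix.mul_assoc, hZ, Matrix.one_mul, Matrix.charpoly_diagonal,
    Finset.prod_eq_multiset_prod, ← Function.comp_def (fun a => Polynomial.X - Polynomial.C a) d,
    ← Multiset.map_map, Polynomial.roots_multiset_prod_X_sub_C]

/-- Any orthogonal diagonalisation of `MᵀM` will do, since its diagonal is the multiset of roots of
the characteristic polynomial. This avoids handling ordered singular values. -/
theorem nuclearNorm_eq_of_gram [DecidableEq m] {M : Matrix m n ℝ} {Z : Matrix n n ℝ} {d : n → ℝ}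
    (hZ : Zᵀ * Z = 1) (h : Mᵀ * M = Z * diagonal d * Zᵀ) :
    nuclearNorm M = ∑ i, √(d i) := by
  have h1 := roots_charpoly_conj_diagonal hZ d
  rw [← h, (isHermitian_gram M).roots_charpoly_eq_eigenvalues] at h1
  have h2 := congrArg (fun s => (s.map Real.sqrt).sum) h1
  simp only [Multiset.map_map] at h2
  rw [nuclearNorm_eq_sum_eigenvalues]
  exact h2

theorem nuclearNorm_nonneg (M : Matrix m n ℝ) : 0 ≤ nuclearNorm M :=
  Finset.sum_nonneg fun _ _ => LinearMap.singularValues_nonneg _ _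

theorem exists_gram_eigen (M : Matrix m n ℝ) : ∃ (Z : Matrix n n ℝ) (d : n → ℝ),
    Zᵀ * Z = 1 ∧ (∀ i, 0 ≤ d i) ∧ Mᵀ * M = Z * diagonal (fun i => d i ^ 2) * Zᵀ := by
  have hS := isHermitian_gram M
  have hZ : (hS.eigenvectorUnitary : Matrix n n ℝ)ᵀ * hS.eigenvectorUnitary = 1 := by
    have h := Unitary.coe_star_mul_self hS.eigenvectorUnitary
    rwa [star_eq_conjTranspose, conjTranspose_eq_transpose_of_trivial] at h
  have hpos : ∀ i, 0 ≤ hS.eigenvalues i := by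
    have : (Mᵀ * M).PosSemidef := by
      simpa [conjTranspose_eq_transpose_of_trivial] using posSemidef_conjTranspose_mul_self M
    exact this.eigenvalues_nonneg
  refine ⟨hS.eigenvectorUnitary, fun i => √(hS.eigenvalues i), hZ, fun i => Real.sqrt_nonneg _, ?_⟩
  have h := hS.spectral_theorem
  rw [Unitary.conjStarAlgAut_apply, star_eq_conjTranspose,
    conjTranspose_eq_transpose_of_trivial] at h
  simp only [Real.sq_sqrt (hpos _)]
  exact h

theorem nuclearNorm_orthogonal_conj {V : Matrix n n ℝ} (hV : V * Vᵀ = 1) (M : Matrix n n ℝ) :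
    nuclearNorm (V * M * Vᵀ) = nuclearNorm M := by
  obtain ⟨Z, d, hZ, hd, h⟩ := exists_gram_eigen M
  have hV' : Vᵀ * V = 1 := mul_eq_one_comm.mp hV
  rw [nuclearNorm_eq_of_gram hZ h]
  refine nuclearNorm_eq_of_gram (Z := V * Z) ?_ ?_
  · rw [transpose_mul, Matrix.mul_assoc, ← Matrix.mul_assoc Vᵀ, hV', Matrix.one_mul, hZ]
  · calc (V * M * Vᵀ)ᵀ * (V * M * Vᵀ) = V * (Mᵀ * (Vᵀ * V) * M) * Vᵀ := by
          simp only [transpose_mul, transpose_transpose, Matrix.mul_assoc]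
      _ = _ := by
          rw [hV', Matrix.mul_one, h]
          simp only [transpose_mul, Matrix.mul_assoc]

theorem nuclearNorm_diagonal (d : n → ℝ) : nuclearNorm (diagonal d) = ∑ i, |d i| := by
  rw [nuclearNorm_eq_of_gram (Z := 1) (d := fun i => d i ^ 2) (by simp)]
  · simp [Real.sqrt_sq_eq_abs]
  · simp [diagonal_transpose, sq]

theorem nuclearNorm_svd {Y Z : Matrix n n ℝ} {d : n → ℝ} (hY : Yᵀ * Y = 1) (hZ : Zᵀ * Z = 1) :
    nuclearNorm (Y * diagonal d * Zᵀ) = ∑ i, |d i| := by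
  rw [nuclearNorm_eq_of_gram (Z := Z) (d := fun i => d i ^ 2) hZ]
  · simp [Real.sqrt_sq_eq_abs]
  · calc (Y * diagonal d * Zᵀ)ᵀ * (Y * diagonal d * Zᵀ)
        = Z * (diagonal d * (Yᵀ * Y) * diagonal d) * Zᵀ := by
          simp only [transpose_mul, transpose_transpose, Matrix.mul_assoc, diagonal_transpose]
      _ = _ := by simp [hY, sq]

/-- `W = M(MᵀM)^(-1/2)`, inverted on the nonzero eigenvalues only, is a partial isometry and `WᵀM =
(MᵀM)^(1/2)`. The convention `0⁻¹ = 0` handles the kernel. -/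
theorem exists_polar (M : Matrix n n ℝ) :
    ∃ W : Matrix n n ℝ, IsContraction W ∧ (Wᵀ * M).trace = nuclearNorm M := by
  obtain ⟨Z, d, hZ, hd, h⟩ := exists_gram_eigen M
  have hZ' : Z * Zᵀ = 1 := mul_eq_one_comm.mp hZ
  refine ⟨M * (Z * diagonal (fun i => (d i)⁻¹) * Zᵀ), ?_, ?_⟩
  · intro x
    set W := M * (Z * diagonal (fun i => (d i)⁻¹) * Zᵀ) with hW
    have hWW : Wᵀ * W = Z * diagonal (fun i => (d i)⁻¹ * d i ^ 2 * (d i)⁻¹) * Zᵀ := by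
      calc Wᵀ * W = Z * diagonal (fun i => (d i)⁻¹) * Zᵀ * (Mᵀ * M) *
            (Z * diagonal (fun i => (d i)⁻¹) * Zᵀ) := by
            simp only [hW, transpose_mul, transpose_transpose, Matrix.mul_assoc,
              diagonal_transpose]
        _ = Z * diagonal (fun i => (d i)⁻¹) * (Zᵀ * Z) * diagonal (fun i => d i ^ 2) * (Zᵀ * Z) *
            diagonal (fun i => (d i)⁻¹) * Zᵀ := by
            rw [h]; simp only [Matrix.mul_assoc]
        _ = _ := by
            rw [hZ, Matrix.mul_one, Matrix.mul_one, Matrix.mul_assoc Z, diagonal_mul_diagonal,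
              Matrix.mul_assoc Z, diagonal_mul_diagonal]
    have h1 : W *ᵥ x ⬝ᵥ W *ᵥ x = (Zᵀ *ᵥ x) ⬝ᵥ
        (diagonal (fun i => (d i)⁻¹ * d i ^ 2 * (d i)⁻¹) *ᵥ (Zᵀ *ᵥ x)) := by
      rw [dotProduct_mulVec, ← mulVec_transpose, mulVec_mulVec, hWW, dotProduct_comm,
        Matrix.mul_assoc, ← mulVec_mulVec, dotProduct_mulVec, ← mulVec_transpose, mulVec_mulVec]
    have h2 : x ⬝ᵥ x = (Zᵀ *ᵥ x) ⬝ᵥ (Zᵀ *ᵥ x) := by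
      rw [dotProduct_mulVec, ← mulVec_transpose, mulVec_mulVec, transpose_transpose, hZ',
        one_mulVec]
    rw [h1, h2]
    simp only [dotProduct, mulVec_diagonal]
    refine Finset.sum_le_sum fun i _ => ?_
    by_cases hi : d i = 0
    · simp [hi, mul_self_nonneg]
    · have : (d i)⁻¹ * d i ^ 2 * (d i)⁻¹ = 1 := by field_simp
      rw [this, one_mul]
  · have h1 : (M * (Z * diagonal (fun i => (d i)⁻¹) * Zᵀ))ᵀ * M
        = Z * diagonal (fun i => (d i)⁻¹ * d i ^ 2) * Zᵀ := by
      calc _ = Z * diagonal (fun i => (d i)⁻¹) * Zᵀ * (Mᵀ * M) := by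
            simp only [transpose_mul, transpose_transpose, Matrix.mul_assoc,
              diagonal_transpose]
        _ = Z * diagonal (fun i => (d i)⁻¹) * (Zᵀ * Z) * diagonal (fun i => d i ^ 2) * Zᵀ := by
            rw [h]; simp only [Matrix.mul_assoc]
        _ = _ := by rw [hZ, Matrix.mul_one, Matrix.mul_assoc Z, diagonal_mul_diagonal]
    rw [h1, Matrix.mul_assoc, trace_mul_comm, Matrix.mul_assoc, hZ, Matrix.mul_one,
      trace_diagonal, nuclearNorm_eq_of_gram hZ h]
    refine Finset.sum_congr rfl fun i _ => ?_
    rw [Real.sqrt_sq (hd i)]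
    by_cases hi : d i = 0
    · simp [hi]
    · field_simp

/-- The other half of the duality: take the trace in an eigenbasis of `MᵀM`, where the columns of
`M` have the singular values as lengths, and apply Cauchy-Schwarz columnwise. -/
theorem IsContraction.trace_mul_le_nuclearNorm {W M : Matrix n n ℝ} (hW : IsContraction W) :
    (Wᵀ * M).trace ≤ nuclearNorm M := by
  obtain ⟨Z, d, hZ, hd, h⟩ := exists_gram_eigen M
  have hZ' : Z * Zᵀ = 1 := mul_eq_one_comm.mp hZ
  have h1 : (Wᵀ * M).trace = ∑ i, (W *ᵥ Z.col i) ⬝ᵥ (M *ᵥ Z.col i) := by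
    calc (Wᵀ * M).trace = ((W * Z)ᵀ * (M * Z)).trace := by
          rw [transpose_mul, Matrix.mul_assoc, trace_mul_comm Zᵀ, Matrix.mul_assoc,
            Matrix.mul_assoc, hZ', Matrix.mul_one]
      _ = _ := by
          simp only [Matrix.trace, Matrix.diag, Matrix.mul_apply, transpose_apply, dotProduct,
            mulVec, Matrix.col]
  have hcol : ∀ i, Z.col i ⬝ᵥ Z.col i = 1 := by
    intro i
    have := congrFun (congrFun hZ i) i
    simpa [Matrix.mul_apply, dotProduct, Matrix.col] using this
  have hM : ∀ i, M *ᵥ Z.col i ⬝ᵥ M *ᵥ Z.col i = d i ^ 2 := by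
    intro i
    have h2 : (M * Z)ᵀ * (M * Z) = diagonal (fun i => d i ^ 2) := by
      calc (M * Z)ᵀ * (M * Z) = Zᵀ * (Mᵀ * M) * Z := by
            simp only [transpose_mul, Matrix.mul_assoc]
        _ = (Zᵀ * Z) * diagonal (fun i => d i ^ 2) * (Zᵀ * Z) := by
            rw [h]; simp only [Matrix.mul_assoc]
        _ = _ := by simp [hZ]
    have h3 : M *ᵥ Z.col i ⬝ᵥ M *ᵥ Z.col i = ((M * Z)ᵀ * (M * Z)) i i := rfl
    rw [h3, h2, diagonal_apply_eq]
  rw [h1, nuclearNorm_eq_of_gram hZ h]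
  refine Finset.sum_le_sum fun i _ => ?_
  apply Real.le_sqrt_of_sq_le
  refine (dotProduct_sq_le _ _).trans ?_
  rw [hM]
  have := hW (Z.col i)
  rw [hcol] at this
  exact mul_le_of_le_one_left (sq_nonneg _) this

theorem nuclearNorm_le_add_sub (M N : Matrix n n ℝ) :
    nuclearNorm M ≤ nuclearNorm N + √(Fintype.card n) * √(sumSq (M - N)) := by
  obtain ⟨W, hW, h⟩ := exists_polar M
  have h1 : (Wᵀ * M).trace = (Wᵀ * N).trace + (Wᵀ * (1 * (M - N))).trace := by
    rw [← trace_add, ← Matrix.mul_add, Matrix.one_mul, add_sub_cancel]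
  rw [← h, h1]
  refine add_le_add hW.trace_mul_le_nuclearNorm ((le_abs_self _).trans ?_)
  refine (abs_trace_contraction_mul_le hW.transpose _ _).trans_eq ?_
  have : sumSq (1 : Matrix n n ℝ) = Fintype.card n := by
    simp [sumSq, Matrix.one_apply]
  rw [this]

/-- Serves the measurability of the error norm. -/
theorem continuous_nuclearNorm : Continuous (nuclearNorm : Matrix n n ℝ → ℝ) := by
  rw [continuous_iff_continuousAt]
  intro N
  have hc : Continuous fun M : Matrix n n ℝ => √(Fintype.card n) * √(sumSq (M - N)) := by
    unfold sumSq
    fun_prop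
  have h0 : Filter.Tendsto (fun M : Matrix n n ℝ => √(Fintype.card n) * √(sumSq (M - N)))
      (nhds N) (nhds 0) := by
    have := hc.tendsto N
    simpa [sumSq] using this
  rw [ContinuousAt, tendsto_iff_dist_tendsto_zero]
  refine squeeze_zero (fun _ => dist_nonneg) (fun M => ?_) h0
  rw [Real.dist_eq, abs_le]
  have h1 := nuclearNorm_le_add_sub M N
  have h2 := nuclearNorm_le_add_sub N M
  have h3 : sumSq (N - M) = sumSq (M - N) := by
    unfold sumSq
    refine Finset.sum_congr rfl fun i _ => Finset.sum_congr rfl fun j _ => ?_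
    simp only [Matrix.sub_apply]
    ring
  rw [h3] at h2
  constructor <;> linarith

end NuclearNorm

/-! ### The error of the best rank-`r` approximation. -/

theorem eq_of_antitone_of_map_eq {n : ℕ} {f g : Fin n → ℝ} (hf : Antitone f) (hg : Antitone g)
    (h : Finset.univ.val.map f = Finset.univ.val.map g) : f = g := by
  rw [Fin.univ_val_map, Fin.univ_val_map, Multiset.coe_eq_coe] at h
  exact List.ofFn_injective (h.eq_of_sortedGE hf.sortedGE_ofFn hg.sortedGE_ofFn)

/-- A singular value decomposition of `A` need not use `V`. Both diagonalise `AᵀA`, so the two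
decreasing sequences `σ²` and `|l|²` agree as multisets and hence as sequences. -/
theorem nuclearNorm_sub_truncated {n r : ℕ} {A V Ar : Matrix (Fin n) (Fin n) ℝ} {l : Fin n → ℝ}
    (hV : IsEigendecomposition A V l) (hAr : IsTruncatedSVD A r Ar) :
    nuclearNorm (A - Ar) = ∑ i, if i.val < r then 0 else |l i| := by
  obtain ⟨Y, Z, σ, hY, hZ, hσ, hσa, hA, hAr⟩ := hAr
  have hY' : Yᵀ * Y = 1 := (Matrix.mem_orthogonalGroup_iff' _ _).mp hY
  have hZ' : Zᵀ * Z = 1 := (Matrix.mem_orthogonalGroup_iff' _ _).mp hZ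
  have hV' : Vᵀ * V = 1 := (Matrix.mem_orthogonalGroup_iff' _ _).mp hV.orthogonal
  have h1 : Aᵀ * A = Z * diagonal (fun i => σ i ^ 2) * Zᵀ := by
    calc Aᵀ * A = Z * (diagonal σ * (Yᵀ * Y) * diagonal σ) * Zᵀ := by
          rw [hA]
          simp only [transpose_mul, transpose_transpose, Matrix.mul_assoc, diagonal_transpose]
      _ = _ := by simp [hY', sq]
  have h2 : Aᵀ * A = V * diagonal (fun i => |l i| ^ 2) * Vᵀ := by
    calc Aᵀ * A = V * (diagonal l * (Vᵀ * V) * diagonal l) * Vᵀ := by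
          rw [hV.eq]
          simp only [transpose_mul, transpose_transpose, Matrix.mul_assoc, diagonal_transpose]
      _ = _ := by simp [hV', sq]
  have h3 : (fun i => σ i ^ 2) = fun i => |l i| ^ 2 := by
    refine eq_of_antitone_of_map_eq ?_ ?_ ?_
    · exact fun i j hij => pow_le_pow_left₀ (hσ j) (hσa hij) 2
    · exact fun i j hij => pow_le_pow_left₀ (abs_nonneg _) (hV.antitone hij) 2
    · rw [← roots_charpoly_conj_diagonal hZ', ← roots_charpoly_conj_diagonal hV', ← h1, ← h2]
  have h4 : ∀ i, σ i = |l i| := fun i =>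
    (pow_left_inj₀ (hσ i) (abs_nonneg _) two_ne_zero).mp (congrFun h3 i)
  have h5 : A - Ar = Y * diagonal (fun i : Fin n => if i.val < r then 0 else σ i) * Zᵀ := by
    rw [hA, hAr, ← Matrix.sub_mul, ← Matrix.mul_sub, diagonal_sub]
    congr 3
    funext i
    split_ifs <;> simp
  rw [h5, nuclearNorm_svd hY' hZ']
  refine Finset.sum_congr rfl fun i _ => ?_
  split_ifs <;> simp [h4]

/-! ### The deterministic error bound in the eigenbasis. -/

section EuclideanBounds

variable {m n : Type*} [Fintype m] [Fintype n]

theorem norm_toLp_sq (x : n → ℝ) : ‖WithLp.toLp 2 x‖ ^ 2 = x ⬝ᵥ x := by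
  rw [EuclideanSpace.real_norm_sq_eq]
  simp [dotProduct, sq]

theorem dotProduct_self_le_of_norm_le {x : m → ℝ} {y : n → ℝ} {c : ℝ}
    (h : ‖WithLp.toLp 2 x‖ ≤ c * ‖WithLp.toLp 2 y‖) : x ⬝ᵥ x ≤ c ^ 2 * (y ⬝ᵥ y) := by
  rw [← norm_toLp_sq, ← norm_toLp_sq, ← mul_pow]
  exact pow_le_pow_left₀ (norm_nonneg _) h 2

theorem norm_le_of_dotProduct_self_le {x : m → ℝ} {y : n → ℝ} {c : ℝ} (hc : 0 ≤ c)
    (h : x ⬝ᵥ x ≤ c ^ 2 * (y ⬝ᵥ y)) : ‖WithLp.toLp 2 x‖ ≤ c * ‖WithLp.toLp 2 y‖ := by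
  rw [← norm_toLp_sq, ← norm_toLp_sq, ← mul_pow] at h
  exact le_of_sq_le_sq h (by positivity)

theorem mulVec_dotProduct_self_le (M : Matrix m n ℝ) (x : n → ℝ) :
    M *ᵥ x ⬝ᵥ M *ᵥ x ≤ sumSq M * (x ⬝ᵥ x) := by
  unfold sumSq
  rw [Finset.sum_mul]
  refine Finset.sum_le_sum fun i _ => ?_
  have := dotProduct_sq_le (fun j => M i j) x
  simpa [mulVec, sq, dotProduct] using this

theorem isContraction_of_isometry [DecidableEq n] {W : Matrix m n ℝ} (h : Wᵀ * W = 1) :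
    IsContraction W := by
  intro x
  rw [dotProduct_mulVec, ← mulVec_transpose, mulVec_mulVec, h, one_mulVec]

theorem isContraction_diagonal [DecidableEq n] {d : n → ℝ} (h : ∀ i, d i ^ 2 ≤ 1) :
    IsContraction (diagonal d) := by
  intro x
  simp only [dotProduct, mulVec_diagonal]
  refine Finset.sum_le_sum fun i _ => ?_
  nlinarith [h i, mul_self_nonneg (x i), mul_le_mul_of_nonneg_right (h i) (mul_self_nonneg (x i))]

theorem sumSq_diagonal [DecidableEq n] (d : n → ℝ) : sumSq (diagonal d) = ∑ i, d i ^ 2 := by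
  unfold sumSq
  refine Finset.sum_congr rfl fun i _ => ?_
  rw [Finset.sum_eq_single i]
  · simp
  · intro j _ hj
    simp [diagonal_apply_ne' _ hj]
  · simp

end EuclideanBounds

/-- The weighted squared Frobenius norm `‖|Λ₃|^(1/2) B‖_F²` of the rows `p, p+1, …` of `K`. -/
def tailEnergy {n r : ℕ} (p : ℕ) (l : Fin n → ℝ) (K : Matrix (Fin n) (Fin r) ℝ) : ℝ :=
  ∑ i : Fin n, if i.val < p then 0 else |l i| * ∑ a, K i a ^ 2

theorem tailEnergy_nonneg {n r p : ℕ} (l : Fin n → ℝ) (K : Matrix (Fin n) (Fin r) ℝ) :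
    0 ≤ tailEnergy p l K := by
  refine Finset.sum_nonneg fun i _ => ?_
  split_ifs
  · exact le_rfl
  · exact mul_nonneg (abs_nonneg _) (Finset.sum_nonneg fun _ _ => sq_nonneg _)

/-- A perturbation of an invertible diagonal matrix by `TᵀST` with `T` small. -/
theorem perturbed_diagonal_bounds {m κ : Type*} [Fintype m] [DecidableEq m] [Fintype κ]
    [DecidableEq κ] {d : κ → ℝ} {δ : ℝ} (hδ : 0 < δ) (hd : ∀ a, δ ≤ |d a|)
    {T : Matrix m κ ℝ} {S : Matrix m m ℝ} (hS : IsContraction S) (hT : sumSq T ≤ δ / 2) :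
    let M := diagonal d + Tᵀ * S * T
    IsUnit M.det ∧ (∀ x, M⁻¹ *ᵥ x ⬝ᵥ M⁻¹ *ᵥ x ≤ (2 / δ) ^ 2 * (x ⬝ᵥ x)) ∧
      ∀ x, (diagonal d * M⁻¹) *ᵥ x ⬝ᵥ (diagonal d * M⁻¹) *ᵥ x ≤ 2 ^ 2 * (x ⬝ᵥ x) := by
  intro M
  set C := Tᵀ * S * T with hC
  -- The operator norm of `TᵀST` is at most `‖T‖_F²`, while `diagonal d` stretches by at least `δ`.
  -- Hence `M` stretches by at least `δ/2`.
  have hCb : ∀ x, ‖WithLp.toLp 2 (C *ᵥ x)‖ ≤ δ / 2 * ‖WithLp.toLp 2 x‖ := by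
    intro x
    refine norm_le_of_dotProduct_self_le (by positivity) ?_
    have h1 : C *ᵥ x = Tᵀ *ᵥ (S *ᵥ (T *ᵥ x)) := by
      rw [hC, ← mulVec_mulVec, ← mulVec_mulVec]
    have h2 := mulVec_dotProduct_self_le Tᵀ (S *ᵥ (T *ᵥ x))
    have h3 := hS (T *ᵥ x)
    have h4 := mulVec_dotProduct_self_le T x
    have h0 := sumSq_nonneg T
    have hx : 0 ≤ x ⬝ᵥ x := by simpa using dotProduct_star_self_nonneg x
    rw [sumSq_transpose] at h2
    rw [h1]
    calc _ ≤ sumSq T * (sumSq T * (x ⬝ᵥ x)) := h2.trans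
          (mul_le_mul_of_nonneg_left (h3.trans h4) h0)
      _ = sumSq T ^ 2 * (x ⬝ᵥ x) := by ring
      _ ≤ _ := by gcongr
  have hDb : ∀ x, δ * ‖WithLp.toLp 2 x‖ ≤ ‖WithLp.toLp 2 (diagonal d *ᵥ x)‖ := by
    intro x
    have h1 : x ⬝ᵥ x ≤ δ⁻¹ ^ 2 * (diagonal d *ᵥ x ⬝ᵥ diagonal d *ᵥ x) := by
      simp only [dotProduct, mulVec_diagonal, Finset.mul_sum]
      refine Finset.sum_le_sum fun a _ => ?_
      have h2 : δ ^ 2 ≤ d a ^ 2 := by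
        rw [← sq_abs (d a)]
        exact pow_le_pow_left₀ hδ.le (hd a) 2
      have h3 : 1 ≤ δ⁻¹ ^ 2 * d a ^ 2 := by
        rw [inv_pow, inv_mul_eq_div, one_le_div (by positivity)]
        exact h2
      nlinarith [mul_le_mul_of_nonneg_right h3 (mul_self_nonneg (x a))]
    have h4 := norm_le_of_dotProduct_self_le (inv_nonneg.mpr hδ.le) h1
    rwa [inv_mul_eq_div, le_div_iff₀ hδ, mul_comm] at h4
  have hMb : ∀ x, δ / 2 * ‖WithLp.toLp 2 x‖ ≤ ‖WithLp.toLp 2 (M *ᵥ x)‖ := by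
    intro x
    have h1 : M *ᵥ x = diagonal d *ᵥ x + C *ᵥ x := add_mulVec _ _ _
    have h2 : WithLp.toLp 2 (diagonal d *ᵥ x)
        = WithLp.toLp 2 (M *ᵥ x) - WithLp.toLp 2 (C *ᵥ x) := by
      rw [h1, WithLp.toLp_add, add_sub_cancel_right]
    have h3 := hDb x
    rw [h2] at h3
    have h4 := norm_sub_le (WithLp.toLp 2 (M *ᵥ x)) (WithLp.toLp 2 (C *ᵥ x))
    have h5 := hCb x
    linarith
  have hM : IsUnit M.det := by
    rw [← Matrix.isUnit_iff_isUnit_det, ← Matrix.mulVec_injective_iff_isUnit]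
    intro x z hxz
    have h1 := hMb (x - z)
    rw [mulVec_sub, hxz, sub_self, WithLp.toLp_zero, norm_zero] at h1
    have h2 : ‖WithLp.toLp 2 (x - z)‖ ≤ 0 := by
      by_contra! h
      nlinarith
    have h3 := norm_le_zero_iff.mp h2
    have h4 : x - z = 0 := (WithLp.toLp_eq_zero 2).mp h3
    exact sub_eq_zero.mp h4
  have hinv : ∀ x, ‖WithLp.toLp 2 (M⁻¹ *ᵥ x)‖ ≤ 2 / δ * ‖WithLp.toLp 2 x‖ := by
    intro x
    have h1 := hMb (M⁻¹ *ᵥ x)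
    rw [mulVec_mulVec, Matrix.mul_nonsing_inv _ hM, one_mulVec] at h1
    rw [div_mul_eq_mul_div, le_div_iff₀ hδ]
    linarith
  refine ⟨hM, fun x => dotProduct_self_le_of_norm_le (hinv x),
    fun x => dotProduct_self_le_of_norm_le ?_⟩
  -- Writing `diagonal d = M - C` gives the norm bound `1 + (δ/2)(2/δ) = 2`, free of the size of
  -- `d`.
  have h1 : (diagonal d * M⁻¹) *ᵥ x = x - C *ᵥ (M⁻¹ *ᵥ x) := by
    have : diagonal d = M - C := (add_sub_cancel_right _ _).symm
    rw [this, Matrix.sub_mul, Matrix.mul_nonsing_inv _ hM, sub_mulVec, one_mulVec, mulVec_mulVec]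
  rw [h1, WithLp.toLp_sub]
  have h2 := hCb (M⁻¹ *ᵥ x)
  have h3 := mul_le_mul_of_nonneg_left (hinv x) (by positivity : 0 ≤ δ / 2)
  have h4 : δ / 2 * (2 / δ * ‖WithLp.toLp 2 x‖) = ‖WithLp.toLp 2 x‖ := by
    field_simp
  linarith [norm_sub_le (WithLp.toLp 2 x) (WithLp.toLp 2 (C *ᵥ (M⁻¹ *ᵥ x)))]

/-- With `D = |Λ₃|^(1/2)` padded by zeros, `S` the signs and `T = DK`, one has `ΛK = K₀Λ₁ + SDT` and
`KᵀΛK = Λ₁ + TᵀST`. In the expanded error every term but the tail of `Λ` is a product of two factors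
whose Frobenius norms are controlled by `y = ‖T‖_F²`, `L = ‖D‖_F²`, `τ` and `δ`. -/
theorem nuclearNorm_sketch_error_le {n r p : ℕ} (hrp : r ≤ p) (hpn : p ≤ n) {l : Fin n → ℝ}
    {δ τ : ℝ} (hδ : 0 < δ) (hl : ∀ i : Fin n, i.val < r → δ ≤ |l i|)
    (hτ0 : 0 ≤ τ) (hτ : ∀ i : Fin n, p ≤ i.val → |l i| ≤ τ)
    {K : Matrix (Fin n) (Fin r) ℝ}
    (hK : ∀ i a, i.val < p → K i a = if i.val = a.val then 1 else 0)
    (hy : tailEnergy p l K ≤ δ / 2) :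
    IsUnit (Kᵀ * diagonal l * K).det ∧
    nuclearNorm (diagonal l - diagonal l * K * (Kᵀ * diagonal l * K)⁻¹ * (Kᵀ * diagonal l)) ≤
      (∑ i : Fin n, if i.val < r then 0 else |l i|) + 2 * tailEnergy p l K
        + 2 * (τ / δ) * tailEnergy p l K
        + 4 * √(∑ i : Fin n, if i.val < p then 0 else |l i|) * √(tailEnergy p l K) := by
  set y := tailEnergy p l K with hydef
  have hy0 : 0 ≤ y := tailEnergy_nonneg l K
  set L := ∑ i : Fin n, if i.val < p then 0 else |l i| with hL
  set D : Matrix (Fin n) (Fin n) ℝ := diagonal fun i => if i.val < p then 0 else √|l i| with hD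
  set S : Matrix (Fin n) (Fin n) ℝ := diagonal fun i => (SignType.sign (l i) : ℝ) with hS
  set K₀ : Matrix (Fin n) (Fin r) ℝ := Matrix.of fun i a => if i.val = a.val then 1 else 0 with hK₀
  set d : Fin r → ℝ := fun a => l ⟨a, by omega⟩ with hd
  set T := D * K with hT
  have hSc : IsContraction S := isContraction_diagonal fun i => by
    rcases lt_trichotomy (l i) 0 with h | h | h <;> simp [h]
  have hTy : sumSq T = y := by
    rw [hydef]
    unfold sumSq tailEnergy
    refine Finset.sum_congr rfl fun i _ => ?_
    rw [hT, hD]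
    simp only [diagonal_mul, mul_pow, ← Finset.mul_sum]
    split_ifs
    · simp
    · rw [Real.sq_sqrt (abs_nonneg _)]
  have hsign : ∀ i, (SignType.sign (l i) : ℝ) * (√|l i| * √|l i|) = l i := fun i => by
    rw [Real.mul_self_sqrt (abs_nonneg _), sign_mul_abs]
  have hΛK : diagonal l * K = K₀ * diagonal d + S * D * T := by
    ext i a
    rw [hT, hS, hD, Matrix.add_apply, mul_diagonal, diagonal_mul, diagonal_mul_diagonal,
      diagonal_mul, diagonal_mul]
    by_cases hi : i.val < p
    · rw [hK i a hi]
      simp only [hK₀, of_apply, hi, if_true, hd]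
      split_ifs with h
      · have : i = ⟨a, by omega⟩ := Fin.ext h
        rw [this]
        simp
      · simp
    · have h : i.val ≠ a.val := by have := a.2; omega
      simp only [hK₀, of_apply, hi, if_false, h, zero_mul, zero_add]
      nth_rewrite 1 [← hsign i]
      ring
  have hKK : Kᵀ * K₀ = 1 := by
    ext a b
    rw [Matrix.mul_apply, Finset.sum_eq_single (⟨b, by omega⟩ : Fin n)]
    · have hb : b.val < p := by omega
      rw [transpose_apply, hK _ _ hb]
      simp [hK₀, Matrix.one_apply, Fin.ext_iff, eq_comm]
    · intro i _ hi
      have : i.val ≠ b.val := fun h => hi (Fin.ext h)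
      simp [hK₀, this]
    · simp
  have hKK₀ : K₀ᵀ * K₀ = 1 := by
    ext a b
    rw [Matrix.mul_apply, Finset.sum_eq_single (⟨b, by omega⟩ : Fin n)]
    · simp [hK₀, Matrix.one_apply, Fin.ext_iff, eq_comm]
    · intro i _ hi
      have : i.val ≠ b.val := fun h => hi (Fin.ext h)
      simp [hK₀, this]
    · simp
  have hDT : Dᵀ = D := diagonal_transpose _
  have hST : Sᵀ = S := diagonal_transpose _
  have hSD : S * D = D * S := by
    rw [hS, hD, diagonal_mul_diagonal, diagonal_mul_diagonal]
    simp only [mul_comm]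
  set M := Kᵀ * diagonal l * K with hM
  have hMeq : M = diagonal d + Tᵀ * S * T := by
    rw [hM, Matrix.mul_assoc, hΛK, Matrix.mul_add, ← Matrix.mul_assoc, hKK, Matrix.one_mul, hSD]
    congr 1
    simp only [hT, transpose_mul, hDT, Matrix.mul_assoc]
  obtain ⟨hMu, hMinv, hH⟩ := perturbed_diagonal_bounds hδ
    (fun a => hl _ (by exact a.2) : ∀ a, δ ≤ |d a|) hSc (hTy.trans_le hy)
  rw [← hMeq] at hMu hMinv hH
  refine ⟨hMu, ?_⟩
  have hMT : Mᵀ = M := by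
    rw [hM]
    simp only [transpose_mul, transpose_transpose, diagonal_transpose, Matrix.mul_assoc]
  have hKΛ : Kᵀ * diagonal l = diagonal d * K₀ᵀ + Tᵀ * (D * S) := by
    have := congrArg Matrix.transpose hΛK
    simpa only [transpose_mul, transpose_add, diagonal_transpose, hDT, hST] using this
  set H := diagonal d * M⁻¹ with hHdef
  have hHT : Hᵀ = M⁻¹ * diagonal d := by
    rw [hHdef, transpose_mul, transpose_nonsing_inv, hMT, diagonal_transpose]
  -- The cancellation of the large eigenvalues: `Λ₁ - Λ₁M⁻¹Λ₁ = H TᵀST`, where `H = Λ₁M⁻¹` has norm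
  -- at most `2`.
  have hHd : H * diagonal d = diagonal d - H * (Tᵀ * S * T) := by
    have h1 : diagonal d = M - Tᵀ * S * T := by rw [hMeq, add_sub_cancel_right]
    have h2 : H * M = diagonal d := by
      rw [hHdef, Matrix.mul_assoc, Matrix.nonsing_inv_mul _ hMu, Matrix.mul_one]
    calc H * diagonal d = H * (M - Tᵀ * S * T) := by rw [← h1]
      _ = _ := by rw [Matrix.mul_sub, h2]
  set Λr : Matrix (Fin n) (Fin n) ℝ := diagonal fun i => if i.val < r then 0 else l i with hΛr
  have hsplit : diagonal l = Λr + K₀ * diagonal d * K₀ᵀ := by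
    ext i j
    rw [Matrix.add_apply, Matrix.mul_apply]
    simp only [mul_diagonal, transpose_apply, hΛr, hK₀, of_apply, hd]
    by_cases hi : i.val < r
    · rw [Finset.sum_eq_single (⟨i, hi⟩ : Fin r)]
      · by_cases hij : i = j
        · subst hij
          simp [hi]
        · have : j.val ≠ i.val := fun h => hij (Fin.ext h.symm)
          simp [hij, this]
      · intro a _ ha
        have : i.val ≠ a.val := fun h => ha (Fin.ext h.symm)
        simp [this]
      · simp
    · rw [Finset.sum_eq_zero]
      · by_cases hij : i = j
        · subst hij
          simp [hi]
        · simp [hij]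
      · intro a _
        have : i.val ≠ a.val := by have := a.2; omega
        simp [this]
  have hE : diagonal l - diagonal l * K * M⁻¹ * (Kᵀ * diagonal l)
      = Λr + (K₀ * (H * Tᵀ)) * (S * (T * K₀ᵀ)) - (K₀ * (H * Tᵀ)) * (D * S)
        - (S * D) * (K₀ * (H * Tᵀ))ᵀ - (S * D * T) * (M⁻¹ * (S * D * T)ᵀ) := by
    have h1 : (K₀ * diagonal d) * M⁻¹ * (diagonal d * K₀ᵀ)
        = K₀ * diagonal d * K₀ᵀ - (K₀ * (H * Tᵀ)) * (S * (T * K₀ᵀ)) := by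
      calc _ = K₀ * (H * diagonal d) * K₀ᵀ := by simp only [hHdef, Matrix.mul_assoc]
        _ = _ := by
          rw [hHd, Matrix.mul_sub, Matrix.sub_mul]
          simp only [Matrix.mul_assoc]
    have h2 : (K₀ * diagonal d) * M⁻¹ * (Tᵀ * (D * S)) = (K₀ * (H * Tᵀ)) * (D * S) := by
      simp only [hHdef, Matrix.mul_assoc]
    have h3 : (S * D * T) * M⁻¹ * (diagonal d * K₀ᵀ) = (S * D) * (K₀ * (H * Tᵀ))ᵀ := by
      simp only [transpose_mul, transpose_transpose, hHT, Matrix.mul_assoc]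
    have h4 : (S * D * T) * M⁻¹ * (Tᵀ * (D * S)) = (S * D * T) * (M⁻¹ * (S * D * T)ᵀ) := by
      simp only [transpose_mul, hDT, hST, Matrix.mul_assoc]
    rw [hΛK, hKΛ, Matrix.add_mul, Matrix.add_mul, Matrix.mul_add, Matrix.mul_add, h1, h2, h3, h4]
    nth_rewrite 1 [hsplit]
    abel
  rw [hE]
  set R := K₀ * (H * Tᵀ) with hR
  set G := S * D * T with hG
  -- A single contraction, dual to the whole error, turns the nuclear norm into a sum of traces that
  -- are bounded separately.
  obtain ⟨W, hW, hWt⟩ := exists_polar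
    (Λr + R * (S * (T * K₀ᵀ)) - R * (D * S) - (S * D) * Rᵀ - G * (M⁻¹ * Gᵀ))
  rw [← hWt, Matrix.mul_sub, Matrix.mul_sub, Matrix.mul_sub, Matrix.mul_add, trace_sub, trace_sub,
    trace_sub, trace_add]
  have hK₀c := isContraction_of_isometry hKK₀
  have hRb : √(sumSq R) ≤ 2 * √y := by
    rw [← Real.sqrt_sq (zero_le_two (α := ℝ)), ← Real.sqrt_mul (by positivity)]
    apply Real.sqrt_le_sqrt
    refine (hK₀c.sumSq_mul_le _).trans ?_
    refine (sumSq_mul_le hH _).trans_eq ?_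
    rw [sumSq_transpose, hTy]
  have hQ₁ : √(sumSq (S * (T * K₀ᵀ))) ≤ √y := by
    apply Real.sqrt_le_sqrt
    refine (hSc.sumSq_mul_le _).trans ?_
    rw [← sumSq_transpose, transpose_mul, transpose_transpose]
    refine (hK₀c.sumSq_mul_le _).trans_eq ?_
    rw [sumSq_transpose, hTy]
  have hDL : sumSq D = L := by
    rw [hD, sumSq_diagonal, hL]
    refine Finset.sum_congr rfl fun i _ => ?_
    split_ifs
    · simp
    · rw [Real.sq_sqrt (abs_nonneg _)]
  have hSDL : √(sumSq (S * D)) ≤ √L := by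
    apply Real.sqrt_le_sqrt
    exact (hSc.sumSq_mul_le _).trans_eq hDL
  have hGb : √(sumSq G) ≤ √(τ * y) := by
    apply Real.sqrt_le_sqrt
    rw [hG, Matrix.mul_assoc]
    refine (hSc.sumSq_mul_le _).trans ?_
    rw [← hTy]
    refine sumSq_mul_le (fun x => ?_) T
    simp only [hD, dotProduct, mulVec_diagonal, Finset.mul_sum]
    refine Finset.sum_le_sum fun i _ => ?_
    split_ifs with hi
    · rw [zero_mul, mul_zero]
      exact mul_nonneg hτ0 (mul_self_nonneg _)
    · have h1 := mul_le_mul_of_nonneg_right (hτ i (not_lt.mp hi)) (mul_self_nonneg (x i))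
      have h2 : √|l i| * x i * (√|l i| * x i) = |l i| * (x i * x i) := by
        rw [mul_mul_mul_comm, Real.mul_self_sqrt (abs_nonneg _)]
      rw [h2]
      exact h1
  have hGb' : √(sumSq (M⁻¹ * Gᵀ)) ≤ 2 / δ * √(sumSq G) := by
    rw [← Real.sqrt_sq (by positivity : (0 : ℝ) ≤ 2 / δ), ← Real.sqrt_mul (by positivity)]
    apply Real.sqrt_le_sqrt
    refine (sumSq_mul_le hMinv _).trans_eq ?_
    rw [sumSq_transpose]
  have hyy : √y * √y = y := Real.mul_self_sqrt hy0
  have t1 : (Wᵀ * Λr).trace ≤ ∑ i : Fin n, if i.val < r then 0 else |l i| := by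
    refine hW.trace_mul_le_nuclearNorm.trans_eq ?_
    rw [hΛr, nuclearNorm_diagonal]
    refine Finset.sum_congr rfl fun i _ => ?_
    split_ifs <;> simp
  have t2 : |(Wᵀ * (R * (S * (T * K₀ᵀ)))).trace| ≤ 2 * y := by
    refine (abs_trace_contraction_mul_le hW.transpose _ _).trans ?_
    calc _ ≤ 2 * √y * √y := by gcongr
      _ = 2 * y := by rw [mul_assoc, hyy]
  have t3 : |(Wᵀ * (R * (D * S))).trace| ≤ 2 * √y * √L := by
    refine (abs_trace_contraction_mul_le hW.transpose _ _).trans ?_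
    rw [← hSD]
    gcongr
  have t4 : |(Wᵀ * (S * D * Rᵀ)).trace| ≤ √L * (2 * √y) := by
    refine (abs_trace_contraction_mul_le hW.transpose _ _).trans ?_
    rw [sumSq_transpose]
    gcongr
  have t5 : |(Wᵀ * (G * (M⁻¹ * Gᵀ))).trace| ≤ 2 * (τ / δ) * y := by
    refine (abs_trace_contraction_mul_le hW.transpose _ _).trans ?_
    calc _ ≤ √(τ * y) * (2 / δ * √(τ * y)) := by
          gcongr
          exact hGb'.trans (by gcongr)
      _ = 2 / δ * (√(τ * y) * √(τ * y)) := by ring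
      _ = 2 * (τ / δ) * y := by
          rw [Real.mul_self_sqrt (by positivity)]
          ring
  rw [abs_le] at t2 t3 t4 t5
  linarith [t2.2, t3.1, t4.1, t5.1]

/-! ### From pseudoinverses to the coefficients `1, 0, B`. -/

section Sketch

theorem isMoorePenroseInverse_conj {s r : Type*} [Fintype s] [Fintype r] [DecidableEq r]
    {U : Matrix s r ℝ} {M : Matrix r r ℝ} (hU : Uᵀ * U = 1) (hM : IsUnit M.det) :
    IsMoorePenroseInverse (U * M * Uᵀ) (U * M⁻¹ * Uᵀ) := by
  have key : ∀ C D : Matrix r r ℝ, U * C * Uᵀ * (U * D * Uᵀ) = U * (C * D) * Uᵀ := by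
    intro C D
    calc _ = U * C * (Uᵀ * U) * D * Uᵀ := by simp only [Matrix.mul_assoc]
      _ = _ := by rw [hU, Matrix.mul_one]; simp only [Matrix.mul_assoc]
  have h1 := Matrix.mul_nonsing_inv M hM
  have h2 := Matrix.nonsing_inv_mul M hM
  constructor
  · rw [key, key, h1, Matrix.one_mul]
  · rw [key, key, h2, Matrix.one_mul]
  · rw [key, h1, Matrix.mul_one, transpose_mul, transpose_transpose]
  · rw [key, h2, Matrix.mul_one, transpose_mul, transpose_transpose]

/-- The pseudoinverse of the compression to the range of `U` is `U(UᵀSU)⁻¹Uᵀ`, an expression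
invariant under the change of basis `R`. That `R` is invertible comes from the determinant of
`FᵀSF`. -/
theorem pinv_projected {s r : Type*} [Fintype s] [Fintype r] [DecidableEq r]
    {U F : Matrix s r ℝ} {R : Matrix r r ℝ} {S : Matrix s s ℝ} (hU : Uᵀ * U = 1) (hF : F = U * R)
    (hM : IsUnit (Fᵀ * S * F).det) :
    pinv (U * Uᵀ * S * (U * Uᵀ)) = F * (Fᵀ * S * F)⁻¹ * Fᵀ := by
  set M := Uᵀ * S * U with hMdef
  have h1 : Fᵀ * S * F = Rᵀ * M * R := by
    rw [hF, hMdef, transpose_mul]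
    simp only [Matrix.mul_assoc]
  rw [h1, det_mul, det_mul, det_transpose] at hM
  have hR : IsUnit R.det := isUnit_of_mul_isUnit_right hM
  have hM' : IsUnit M.det := isUnit_of_mul_isUnit_right (isUnit_of_mul_isUnit_left hM)
  have hRT : IsUnit Rᵀ.det := by rwa [det_transpose]
  have h2 : F * (Fᵀ * S * F)⁻¹ * Fᵀ = U * M⁻¹ * Uᵀ := by
    rw [h1, hF, Matrix.mul_inv_rev, Matrix.mul_inv_rev, transpose_mul]
    calc _ = U * (R * R⁻¹) * M⁻¹ * (Rᵀ⁻¹ * Rᵀ) * Uᵀ := by simp only [Matrix.mul_assoc]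
      _ = _ := by
        rw [Matrix.mul_nonsing_inv _ hR, Matrix.nonsing_inv_mul _ hRT, Matrix.mul_one,
          Matrix.mul_one]
  have h3 : U * Uᵀ * S * (U * Uᵀ) = U * M * Uᵀ := by
    rw [hMdef]
    simp only [Matrix.mul_assoc]
  rw [h2, h3]
  exact (pinv_spec _).unique (isMoorePenroseInverse_conj hU hM')

/-- The first `r` columns of the pseudoinverse `Nᵀ (N Nᵀ)⁻¹` of a matrix of full row rank. -/
noncomputable def dualFrame {p s : ℕ} (r : ℕ) (hrp : r ≤ p) (N : Matrix (Fin p) (Fin s) ℝ) :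
    Matrix (Fin s) (Fin r) ℝ :=
  (Nᵀ * (N * Nᵀ)⁻¹).submatrix id (Fin.castLE hrp)

theorem mul_dualFrame {p s r : ℕ} (hrp : r ≤ p) {N : Matrix (Fin p) (Fin s) ℝ}
    (hN : IsUnit (N * Nᵀ).det) (i : Fin p) (a : Fin r) :
    (N * dualFrame r hrp N) i a = if i.val = a.val then 1 else 0 := by
  have h1 : (N * dualFrame r hrp N) i a = (N * (Nᵀ * (N * Nᵀ)⁻¹)) i (Fin.castLE hrp a) := rfl
  rw [h1, ← Matrix.mul_assoc, Matrix.mul_nonsing_inv _ hN, Matrix.one_apply]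
  simp [Fin.ext_iff]

/-- The columns of `F` are dual to the first `r` rows of `N` and orthogonal to the others, so they
lie in the range of `Q` and `QᵀF` is a right inverse of `X₁Q`. Of the Penrose conditions only the
symmetry of `QᵀF X₁Q` is not immediate. -/
theorem mul_pinv_eq_dualFrame {p s r q : ℕ} (hrp : r ≤ p) {N : Matrix (Fin p) (Fin s) ℝ}
    (hN : IsUnit (N * Nᵀ).det) {X₁ : Matrix (Fin r) (Fin s) ℝ}
    {X₂ : Matrix (Fin (p - r)) (Fin s) ℝ} {Q : Matrix (Fin s) (Fin q) ℝ}
    (hX₁ : ∀ a, X₁ a = N (Fin.castLE hrp a)) (hX₂ : ∀ k : Fin (p - r), X₂ k = N ⟨r + k, by omega⟩)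
    (hQ : IsOrthonormalComplement X₂ᵀ Q) :
    Q * pinv (X₁ * Q) = dualFrame r hrp N ∧ X₁ * Q * pinv (X₁ * Q) = 1 := by
  set F := dualFrame r hrp N with hF
  have h1F : X₁ * F = 1 := by
    ext a b
    have : (X₁ * F) a b = (N * F) (Fin.castLE hrp a) b := by
      simp only [Matrix.mul_apply, hX₁]
    rw [this, mul_dualFrame hrp hN, Matrix.one_apply]
    simp [Fin.ext_iff]
  have h2F : X₂ * F = 0 := by
    ext k b
    have : (X₂ * F) k b = (N * F) ⟨r + k, by omega⟩ b := by
      simp only [Matrix.mul_apply, hX₂]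
    rw [this, mul_dualFrame hrp hN, if_neg (by simp only; omega)]
    rfl
  have h2Q : X₂ * Q = 0 := by
    ext k j
    have h := (hQ.range_eq (Q *ᵥ Pi.single j 1)).mpr ⟨_, rfl⟩
    rw [transpose_transpose, mulVec_mulVec] at h
    simpa using congrFun h k
  have hQF : Q * (Qᵀ * F) = F := by
    ext i b
    obtain ⟨w, hw⟩ := (hQ.range_eq (F.col b)).mp (by
      rw [transpose_transpose]
      ext k
      exact congrFun (congrFun h2F k) b)
    have : (Q * (Qᵀ * F)) i b = (Q *ᵥ (Qᵀ *ᵥ F.col b)) i := rfl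
    rw [this, ← hw, mulVec_mulVec (M := Qᵀ), hQ.orthonormal, one_mulVec, hw]
    rfl
  set J : Matrix (Fin p) (Fin r) ℝ := (1 : Matrix (Fin p) (Fin p) ℝ).submatrix id (Fin.castLE hrp)
    with hJ
  have hNQ : N * Q = J * (X₁ * Q) := by
    ext i j
    by_cases hi : i.val < r
    · have : (J * (X₁ * Q)) i j = (X₁ * Q) ⟨i, hi⟩ j := by
        rw [Matrix.mul_apply, Finset.sum_eq_single ⟨i, hi⟩]
        · simp [hJ, Matrix.one_apply]
        · intro a _ ha
          have : i ≠ Fin.castLE hrp a := fun h => ha (Fin.ext (congrArg Fin.val h).symm)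
          simp [hJ, this]
        · simp
      rw [this]
      simp only [Matrix.mul_apply, hX₁]
      rfl
    · have h1 : (J * (X₁ * Q)) i j = 0 := by
        rw [Matrix.mul_apply]
        refine Finset.sum_eq_zero fun a _ => ?_
        have : i ≠ Fin.castLE hrp a := fun h => hi (by rw [h]; exact a.2)
        simp [hJ, this]
      have h2 := congrFun (congrFun h2Q ⟨i - r, by omega⟩) j
      rw [h1]
      have h3 : (⟨r + (i.val - r), by omega⟩ : Fin p) = i := Fin.ext (by simp only; omega)
      simp only [Matrix.mul_apply, hX₂, h3] at h2
      exact h2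
  have hFJ : F = Nᵀ * (N * Nᵀ)⁻¹ * J := by
    ext i a
    rw [Matrix.mul_apply]
    simp [hF, hJ, dualFrame, Matrix.one_apply]
  have h1QF : X₁ * Q * (Qᵀ * F) = 1 := by
    rw [Matrix.mul_assoc, hQF, h1F]
  have hpinv : pinv (X₁ * Q) = Qᵀ * F := by
    refine (pinv_spec _).unique ⟨?_, ?_, ?_, ?_⟩
    · rw [h1QF, Matrix.one_mul]
    · rw [Matrix.mul_assoc (Qᵀ * F), h1QF, Matrix.mul_one]
    · rw [h1QF, transpose_one]
    -- Since `X₂Q = 0`, padding `X₁Q` with zero rows gives `NQ`, which makes the product visibly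
    -- symmetric.
    · have h3 : Qᵀ * F * (X₁ * Q) = (N * Q)ᵀ * (N * Nᵀ)⁻¹ * (N * Q) := by
        nth_rewrite 2 [hNQ]
        rw [hFJ, transpose_mul]
        simp only [Matrix.mul_assoc]
      rw [h3]
      simp only [transpose_mul, transpose_transpose, transpose_nonsing_inv, Matrix.mul_assoc]
  rw [hpinv]
  exact ⟨hQF, h1QF⟩

theorem sum_blockIdx {n : ℕ} (a k : ℕ) (h : a + k ≤ n) (f : Fin n → ℝ) :
    ∑ j, f (blockIdx a k h j) = ∑ i : Fin n, if a ≤ i.val ∧ i.val < a + k then f i else 0 := by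
  rw [← Finset.sum_filter]
  refine Finset.sum_bij (fun j _ => blockIdx a k h j) ?_ ?_ ?_ ?_
  · intro j _
    simp [blockIdx]
  · intro i _ j _ hij
    have := congrArg Fin.val hij
    simp only [blockIdx] at this
    exact Fin.ext (by omega)
  · intro i hi
    rw [Finset.mem_filter] at hi
    exact ⟨⟨i - a, by omega⟩, Finset.mem_univ _, Fin.ext (by simp only [blockIdx]; omega)⟩
  · intro _ _
    rfl

theorem nuclearNorm_diagBlock {n : ℕ} (l : Fin n → ℝ) (a k : ℕ) (h : a + k ≤ n) :
    nuclearNorm (diagBlock l a k h)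
      = ∑ i : Fin n, if a ≤ i.val ∧ i.val < a + k then |l i| else 0 := by
  have hinj : Function.Injective (blockIdx a k h) := fun i j hij => by
    have := congrArg Fin.val hij
    simp only [blockIdx] at this
    exact Fin.ext (by omega)
  unfold diagBlock
  rw [Matrix.submatrix_diagonal _ _ hinj, nuclearNorm_diagonal]
  exact sum_blockIdx a k h fun i => |l i|

theorem nuclearNorm_tailBlock {n p : ℕ} (l : Fin n → ℝ) (h : p + (n - p) ≤ n) :
    nuclearNorm (diagBlock l p (n - p) h) = ∑ i : Fin n, if i.val < p then 0 else |l i| := by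
  rw [nuclearNorm_diagBlock]
  refine Finset.sum_congr rfl fun i _ => ?_
  have := i.2
  split_ifs <;> first | rfl | omega

theorem nuclearNorm_midBlock_add_tailBlock {n r p : ℕ} (hrp : r ≤ p) (l : Fin n → ℝ)
    (h₂ : r + (p - r) ≤ n) (h₃ : p + (n - p) ≤ n) :
    nuclearNorm (diagBlock l r (p - r) h₂) + nuclearNorm (diagBlock l p (n - p) h₃)
      = ∑ i : Fin n, if i.val < r then 0 else |l i| := by
  rw [nuclearNorm_diagBlock, nuclearNorm_diagBlock, ← Finset.sum_add_distrib]
  refine Finset.sum_congr rfl fun i _ => ?_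
  have := i.2
  split_ifs <;> first | omega | simp

theorem frobeniusNorm_tail_sq {n r p : ℕ} (l : Fin n → ℝ) (h : p + (n - p) ≤ n)
    (K : Matrix (Fin n) (Fin r) ℝ) :
    frobeniusNorm ((diagBlock l p (n - p) h).map (fun x => √|x|) *
      K.submatrix (blockIdx p (n - p) h) id) ^ 2 = tailEnergy p l K := by
  have hinj : Function.Injective (blockIdx p (n - p) h) := fun i j hij => by
    have := congrArg Fin.val hij
    simp only [blockIdx] at this
    exact Fin.ext (by omega)
  rw [frobeniusNorm_sq]
  unfold diagBlock
  rw [Matrix.submatrix_diagonal _ _ hinj, diagonal_map (by simp)]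
  have h1 := sum_blockIdx p (n - p) h fun i => |l i| * ∑ a, K i a ^ 2
  unfold sumSq tailEnergy
  calc _ = ∑ j, |l (blockIdx p (n - p) h j)| * ∑ a, K (blockIdx p (n - p) h j) a ^ 2 := by
        refine Finset.sum_congr rfl fun j _ => ?_
        simp only [diagonal_mul, mul_pow, ← Finset.mul_sum, Function.comp,
          Real.sq_sqrt (abs_nonneg _), submatrix_apply, id]
    _ = _ := by
        rw [h1]
        refine Finset.sum_congr rfl fun i _ => ?_
        have := i.2
        split_ifs <;> first | rfl | omega

end Sketch

/-! ### Gaussian vectors: resampling, rotation invariance, inverse moments. -/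

section Gaussian

/-- Tonelli in the form used to condition on all rows but one: the row is replaced by an independent
copy. -/
theorem lintegral_pi_resample {ι : Type*} [Fintype ι] [DecidableEq ι] {X : ι → Type*}
    [∀ i, MeasurableSpace (X i)] (μ : ∀ i, Measure (X i)) [∀ i, IsProbabilityMeasure (μ i)]
    {f : (∀ i, X i) → ℝ≥0∞} (hf : Measurable f) (i : ι) :
    ∫⁻ z, f z ∂Measure.pi μ
      = ∫⁻ z, (∫⁻ x, f (Function.update z i x) ∂μ i) ∂Measure.pi μ := by
  have hg : Measurable fun z : ∀ i, X i => ∫⁻ x, f (Function.update z i x) ∂μ i := by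
    refine Measurable.lintegral_prod_right' (f := fun p : (∀ i, X i) × X i =>
      f (Function.update p.1 i p.2)) ?_
    refine hf.comp (measurable_pi_lambda _ fun j => ?_)
    by_cases h : j = i
    · subst h
      simpa using measurable_snd
    · simp only [Function.update_of_ne h]
      fun_prop
  obtain ⟨z₀⟩ : Nonempty (∀ i, X i) := nonempty_of_isProbabilityMeasure (Measure.pi μ)
  rw [lintegral_eq_lmarginal_univ z₀, lintegral_eq_lmarginal_univ z₀,
    lmarginal_erase' _ hf (Finset.mem_univ i), lmarginal_erase' _ hg (Finset.mem_univ i)]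
  simp

/-- The law of a vector of independent centred Gaussians of common variance `v`. -/
noncomputable def gaussianVector (ι : Type*) [Fintype ι] (v : ℝ≥0) : Measure (ι → ℝ) :=
  Measure.pi fun _ => gaussianReal 0 v

instance {ι : Type*} [Fintype ι] (v : ℝ≥0) : IsProbabilityMeasure (gaussianVector ι v) := by
  unfold gaussianVector
  infer_instance

variable {ι : Type*} [Fintype ι]

theorem gaussianVector_eq_map (v : ℝ≥0) :
    gaussianVector ι v = (gaussianVector ι 1).map (fun x i => √(v : ℝ) * x i) := by
  unfold gaussianVector
  rw [Measure.pi_map_pi (fun i => (measurable_const_mul _).aemeasurable)]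
  congr 1
  funext i
  rw [gaussianReal_map_const_mul, mul_zero, mul_one]
  congr 1
  ext
  simp

theorem measurable_mulVec {κ : Type*} [Fintype κ] (O : Matrix κ ι ℝ) :
    Measurable fun x : ι → ℝ => O *ᵥ x := by
  refine measurable_pi_lambda _ fun i => ?_
  simp only [mulVec, dotProduct]
  fun_prop

theorem gaussianVector_map_orthogonal [DecidableEq ι] (v : ℝ≥0) {O : Matrix ι ι ℝ}
    (hO : Oᵀ * O = 1) : (gaussianVector ι v).map (fun x => O *ᵥ x) = gaussianVector ι v := by
  have h1 : (gaussianVector ι 1).map (fun x => O *ᵥ x) = gaussianVector ι 1 := by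
    let f : EuclideanSpace ℝ ι →ₗᵢ[ℝ] EuclideanSpace ℝ ι :=
      ⟨Matrix.toEuclideanLin O, fun x => by
        rw [← sq_eq_sq₀ (norm_nonneg _) (norm_nonneg _)]
        have h2 : Matrix.toEuclideanLin O x = WithLp.toLp 2 (O *ᵥ x.ofLp) := rfl
        have h3 : x = WithLp.toLp 2 x.ofLp := rfl
        rw [h2]
        nth_rewrite 2 [h3]
        rw [norm_toLp_sq, norm_toLp_sq, dotProduct_mulVec, ← mulVec_transpose, mulVec_mulVec, hO,
          one_mulVec]⟩
    let g := f.toLinearIsometryEquiv rfl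
    have hg : ∀ x : ι → ℝ, g (WithLp.toLp 2 x) = WithLp.toLp 2 (O *ᵥ x) := fun x => rfl
    have h4 : (gaussianVector ι 1).map (WithLp.toLp 2) = stdGaussian (EuclideanSpace ℝ ι) :=
      map_pi_eq_stdGaussian
    have h5 : (gaussianVector ι 1).map (fun x => g (WithLp.toLp 2 x))
        = (gaussianVector ι 1).map (WithLp.toLp 2) := by
      rw [h4, ← stdGaussian_map g, ← h4, Measure.map_map (by fun_prop) (by fun_prop)]
      rfl
    have h6 := congrArg (fun μ => μ.map (WithLp.ofLp)) h5
    simp only at h6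
    rw [Measure.map_map (by fun_prop) (by fun_prop), Measure.map_map (by fun_prop) (by fun_prop)]
      at h6
    have h7 : (WithLp.ofLp ∘ WithLp.toLp 2 : (ι → ℝ) → ι → ℝ) = id := rfl
    rw [h7, Measure.map_id] at h6
    exact h6
  rw [gaussianVector_eq_map v, Measure.map_map (measurable_mulVec O) (by fun_prop)]
  nth_rewrite 2 [← h1]
  rw [Measure.map_map (by fun_prop) (measurable_mulVec O)]
  congr 1
  funext x
  exact mulVec_smul O (√(v : ℝ)) x

theorem lintegral_exp_neg_mul_sq_gaussianReal {v : ℝ≥0} (hv : v ≠ 0) {t : ℝ} (ht : 0 < t) :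
    ∫⁻ x, ENNReal.ofReal (Real.exp (-t * x ^ 2)) ∂gaussianReal 0 v
      = ENNReal.ofReal ((1 + 2 * v * t) ^ (-(1 / 2) : ℝ)) := by
  have hv' : (0 : ℝ) < v := by positivity
  rw [← ofReal_integral_eq_lintegral_ofReal]
  · congr 1
    rw [integral_gaussianReal_eq_integral_smul hv]
    have h1 : ∀ x : ℝ, gaussianPDFReal 0 v x • Real.exp (-t * x ^ 2)
        = (√(2 * Real.pi * v))⁻¹ * Real.exp (-(t + 1 / (2 * v)) * x ^ 2) := by
      intro x
      rw [gaussianPDFReal_def, smul_eq_mul, mul_assoc, ← Real.exp_add]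
      congr 2
      field_simp
      ring
    simp_rw [h1]
    rw [integral_const_mul, integral_gaussian, Real.rpow_neg (by positivity),
      ← Real.sqrt_eq_rpow, ← Real.sqrt_inv, ← Real.sqrt_inv, ← Real.sqrt_mul (by positivity)]
    congr 1
    field_simp
    ring
  · refine Integrable.of_bound (C := 1) (by fun_prop) (ae_of_all _ fun x => ?_)
    rw [Real.norm_eq_abs, Real.abs_exp, Real.exp_le_one_iff]
    nlinarith [sq_nonneg x]
  · exact ae_of_all _ fun x => (Real.exp_pos _).le

theorem lintegral_exp_neg_mul_sum_sq {v : ℝ≥0} (hv : v ≠ 0) {t : ℝ} (ht : 0 < t)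
    (S : Finset ι) :
    ∫⁻ x, ENNReal.ofReal (Real.exp (-t * ∑ i ∈ S, x i ^ 2)) ∂gaussianVector ι v
      = ENNReal.ofReal ((1 + 2 * v * t) ^ (-(S.card / 2) : ℝ)) := by
  have h1 : ∀ x : ι → ℝ, ENNReal.ofReal (Real.exp (-t * ∑ i ∈ S, x i ^ 2))
      = ∏ i ∈ S, ENNReal.ofReal (Real.exp (-t * x i ^ 2)) := by
    intro x
    rw [Finset.mul_sum, Real.exp_sum, ENNReal.ofReal_prod_of_nonneg fun i _ => (Real.exp_pos _).le]
  simp_rw [h1]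
  have hm : Measurable fun y : ℝ => ENNReal.ofReal (Real.exp (-t * y ^ 2)) := by fun_prop
  unfold gaussianVector
  rw [lintegral_prod_eq_prod_lintegral_of_indepFun S
    (fun i (x : ι → ℝ) => ENNReal.ofReal (Real.exp (-t * x i ^ 2)))
    (iIndepFun_pi (μ := fun _ : ι => gaussianReal 0 v) fun _ => hm.aemeasurable) (fun i => by fun_prop)]
  have h2 : ∀ i : ι, ∫⁻ x : ι → ℝ, ENNReal.ofReal (Real.exp (-t * x i ^ 2))
      ∂Measure.pi (fun _ => gaussianReal 0 v) = ENNReal.ofReal ((1 + 2 * v * t) ^ (-(1 / 2) : ℝ)) := by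
    intro i
    rw [← lintegral_exp_neg_mul_sq_gaussianReal hv ht,
      ← (measurePreserving_eval (fun _ : ι => gaussianReal 0 v) i).lintegral_comp hm]
  have h0 : (0 : ℝ) ≤ 1 + 2 * v * t := by positivity
  rw [Finset.prod_congr rfl fun i _ => h2 i, Finset.prod_const, ← ENNReal.ofReal_pow (by positivity),
    ← Real.rpow_natCast, ← Real.rpow_mul h0]
  congr 2
  ring

/-- Reduces inverse moments to Laplace transforms, which factor over independent coordinates. At `q
= 0` both sides are infinite. -/
theorem inv_ofReal_eq_lintegral_exp {q : ℝ} (hq : 0 ≤ q) :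
    (ENNReal.ofReal q)⁻¹ = ∫⁻ t in Set.Ioi (0 : ℝ), ENNReal.ofReal (Real.exp (-t * q)) := by
  rcases hq.eq_or_lt with rfl | hq
  · simp
  · have h1 : ∀ t : ℝ, -t * q = -q * t := fun t => by ring
    simp_rw [h1]
    rw [← ofReal_integral_eq_lintegral_ofReal]
    · rw [integral_exp_mul_Ioi (by linarith), ← ENNReal.ofReal_inv_of_pos hq]
      congr 1
      simp [neg_div]
    · exact integrableOn_exp_mul_Ioi (by linarith) _
    · exact ae_of_all _ fun x => (Real.exp_pos _).le

theorem lintegral_rpow_affine_Ioi {v k : ℝ} (hv : 0 < v) (hk : 2 < k) :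
    ∫⁻ t in Set.Ioi (0 : ℝ), ENNReal.ofReal ((1 + 2 * v * t) ^ (-(k / 2)))
      = ENNReal.ofReal (1 / (v * (k - 2))) := by
  -- An antiderivative of the integrand; it tends to `0` at infinity because `k > 2`.
  set g : ℝ → ℝ := fun t => -(1 / (v * (k - 2))) * (1 + 2 * v * t) ^ (1 - k / 2) with hg
  have hk' : 0 < k - 2 := by linarith
  have hd : ∀ t ∈ Set.Ici (0 : ℝ), HasDerivAt g ((1 + 2 * v * t) ^ (-(k / 2))) t := by
    intro t ht
    have ht' : (0 : ℝ) ≤ t := ht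
    have h0 : 0 < 1 + 2 * v * t := by positivity
    have h1 : HasDerivAt (fun t => 1 + 2 * v * t) (2 * v) t := by
      simpa using ((hasDerivAt_id t).const_mul (2 * v)).const_add 1
    have h2 := (h1.rpow_const (p := 1 - k / 2) (Or.inl h0.ne')).const_mul (-(1 / (v * (k - 2))))
    have h3 : 1 - k / 2 - 1 = -(k / 2) := by ring
    have h4 : (1 + 2 * v * t) ^ (-(k / 2))
        = -(1 / (v * (k - 2))) * (2 * v * (1 - k / 2) * (1 + 2 * v * t) ^ (1 - k / 2 - 1)) := by
      rw [h3]
      field_simp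
      ring
    rw [h4]
    exact h2
  have hpos : ∀ t ∈ Set.Ioi (0 : ℝ), 0 ≤ (1 + 2 * v * t) ^ (-(k / 2)) := by
    intro t ht
    have ht' : (0 : ℝ) < t := ht
    positivity
  have hlim : Filter.Tendsto g Filter.atTop (nhds 0) := by
    have h1 : Filter.Tendsto (fun t : ℝ => 1 + 2 * v * t) Filter.atTop Filter.atTop :=
      Filter.tendsto_atTop_add_const_left _ _
        (Filter.tendsto_id.const_mul_atTop (by positivity : 0 < 2 * v))
    have h2 := (tendsto_rpow_neg_atTop (y := k / 2 - 1) (by linarith)).comp h1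
    have h3 := h2.const_mul (-(1 / (v * (k - 2))))
    rw [mul_zero] at h3
    refine h3.congr fun t => ?_
    simp only [hg, Function.comp]
    congr 2
    ring
  rw [← ofReal_integral_eq_lintegral_ofReal]
  · rw [integral_Ioi_of_hasDerivAt_of_nonneg' hd hpos hlim]
    simp [hg]
  · exact integrableOn_Ioi_deriv_of_nonneg' hd hpos hlim
  · exact (ae_restrict_iff' measurableSet_Ioi).mpr (ae_of_all _ hpos)

/-- The expectation of the inverse of a `χ²` variable. -/
theorem lintegral_inv_sum_sq {v : ℝ≥0} (hv : v ≠ 0) (S : Finset ι) (hS : 2 < S.card) :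
    ∫⁻ x, (ENNReal.ofReal (∑ i ∈ S, x i ^ 2))⁻¹ ∂gaussianVector ι v
      = ENNReal.ofReal (1 / (v * (S.card - 2))) := by
  have hq : ∀ x : ι → ℝ, 0 ≤ ∑ i ∈ S, x i ^ 2 := fun x => Finset.sum_nonneg fun _ _ => sq_nonneg _
  simp_rw [fun x => inv_ofReal_eq_lintegral_exp (hq x)]
  rw [lintegral_lintegral_swap]
  · rw [← lintegral_rpow_affine_Ioi (by positivity) (by exact_mod_cast hS)]
    refine setLIntegral_congr_fun measurableSet_Ioi fun t ht => ?_
    exact lintegral_exp_neg_mul_sum_sq hv ht S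
  · refine Measurable.aemeasurable ?_
    fun_prop

end Gaussian

/-! ### The law of the sketch in the eigenbasis. -/

/-- The law of an `n × s` matrix, given by its rows, of independent centred Gaussians of common
variance `v`. -/
noncomputable def gaussianRows (n s : ℕ) (v : ℝ≥0) : Measure (Fin n → Fin s → ℝ) :=
  Measure.pi fun _ => gaussianVector (Fin s) v

instance (n s : ℕ) (v : ℝ≥0) : IsProbabilityMeasure (gaussianRows n s v) := by
  unfold gaussianRows
  infer_instance

theorem gaussianVector_map_curry (n s : ℕ) (v : ℝ≥0) :
    (gaussianVector (Fin n × Fin s) v).map Function.curry = gaussianRows n s v := by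
  have h1 : gaussianVector (Fin n × Fin s) v = (gaussianRows n s v).map Function.uncurry := by
    refine Measure.pi_eq fun t ht => ?_
    rw [Measure.map_apply (by fun_prop) (MeasurableSet.univ_pi ht)]
    have h2 : Function.uncurry ⁻¹' Set.pi Set.univ t
        = Set.pi Set.univ fun i : Fin n => Set.pi Set.univ fun j : Fin s => t (i, j) := by
      ext z
      simp [Set.mem_pi, Function.uncurry]
    rw [h2, gaussianRows, Measure.pi_pi, Fintype.prod_prod_type]
    refine Finset.prod_congr rfl fun i _ => ?_
    rw [gaussianVector, Measure.pi_pi]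
  rw [h1, Measure.map_map (by fun_prop) (by fun_prop)]
  exact Measure.map_id

theorem IsGaussianMatrix.law_orthogonal_mul {Ω : Type*} [MeasurableSpace Ω] {n s : ℕ}
    {X : Ω → Matrix (Fin n) (Fin s) ℝ} {v : ℝ≥0} {μ : Measure Ω} [IsProbabilityMeasure μ]
    (hX : IsGaussianMatrix X v μ) {V : Matrix (Fin n) (Fin n) ℝ} (hV : V * Vᵀ = 1) :
    AEMeasurable (fun ω i j => (Vᵀ * X ω) i j) μ ∧
      μ.map (fun ω i j => (Vᵀ * X ω) i j) = gaussianRows n s v := by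
  have hm : ∀ i j, AEMeasurable (fun ω => X ω i j) μ := fun i j => (hX.hasLaw i j).aemeasurable
  have hm' : AEMeasurable (fun ω (ij : Fin n × Fin s) => X ω ij.1 ij.2) μ :=
    aemeasurable_pi_lambda _ fun ij => hm ij.1 ij.2
  have h1 : μ.map (fun ω (ij : Fin n × Fin s) => X ω ij.1 ij.2)
      = gaussianVector (Fin n × Fin s) v := by
    refine (hX.indep.map_fun_eq_pi_map fun ij : Fin n × Fin s => hm ij.1 ij.2).trans ?_
    unfold gaussianVector
    congr 1
    funext ij
    exact (hX.hasLaw ij.1 ij.2).map_eq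
  -- Left multiplication by `Vᵀ`, acting on the matrix flattened to a vector: `Vᵀ` on each column,
  -- hence orthogonal.
  set O : Matrix (Fin n × Fin s) (Fin n × Fin s) ℝ :=
    Matrix.of fun ij kl => if ij.2 = kl.2 then V kl.1 ij.1 else 0 with hO
  have hOO : Oᵀ * O = 1 := by
    ext ⟨i, j⟩ ⟨k, l⟩
    have h2 : (V * Vᵀ) i k = (1 : Matrix (Fin n) (Fin n) ℝ) i k := by rw [hV]
    rw [Matrix.mul_apply] at h2 ⊢
    rw [Fintype.sum_prod_type]
    simp only [hO, transpose_apply, of_apply, ite_mul, zero_mul, mul_ite, mul_zero]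
    simp only [Finset.sum_ite_eq', Finset.mem_univ, if_true, transpose_apply] at h2 ⊢
    by_cases hjl : j = l
    · subst hjl
      simp [h2, Matrix.one_apply]
    · simp [hjl, Ne.symm hjl]
  have h3 : (fun ω i j => (Vᵀ * X ω) i j)
      = (Function.curry ∘ fun x => O *ᵥ x) ∘ fun ω (ij : Fin n × Fin s) => X ω ij.1 ij.2 := by
    funext ω i j
    simp only [Function.comp, Function.curry, mulVec, dotProduct, Matrix.mul_apply,
      Fintype.sum_prod_type, hO, of_apply, ite_mul, zero_mul, Finset.sum_ite_eq, Finset.mem_univ,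
      if_true, transpose_apply]
  have hmc : Measurable (Function.curry ∘ fun x : Fin n × Fin s → ℝ => O *ᵥ x) :=
    measurable_curry.comp (measurable_mulVec O)
  rw [h3]
  refine ⟨hmc.comp_aemeasurable hm', ?_⟩
  rw [← AEMeasurable.map_map_of_aemeasurable hmc.aemeasurable hm', h1,
    ← Measure.map_map measurable_curry (measurable_mulVec O), gaussianVector_map_orthogonal v hOO,
    gaussianVector_map_curry]

/-! ### Full row rank and the diagonal of the inverse Gram matrix. -/

section Rank

theorem isUnit_det_mul_transpose_iff {κ ι : Type*} [Fintype κ] [DecidableEq κ] [Fintype ι]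
    (N : Matrix κ ι ℝ) : IsUnit (N * Nᵀ).det ↔ ∀ c, Nᵀ *ᵥ c = 0 → c = 0 := by
  rw [isUnit_iff_ne_zero, ← not_iff_not, not_not, ← Matrix.exists_mulVec_eq_zero_iff]
  push Not
  refine exists_congr fun c => ?_
  rw [and_comm]
  refine and_congr_left fun _ => ⟨fun h => ?_, fun h => ?_⟩
  · have h1 : Nᵀ *ᵥ c ⬝ᵥ Nᵀ *ᵥ c = 0 := by
      rw [dotProduct_mulVec, ← mulVec_transpose, mulVec_mulVec, transpose_transpose, h,
        zero_dotProduct]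
    exact dotProduct_self_eq_zero.mp h1
  · rw [← mulVec_mulVec, h, mulVec_zero]

/-- Coordinates adapted to the row space of `W` and its orthogonal complement. -/
theorem exists_adapted_coordinates {κ ι : Type*} [Fintype κ] [Fintype ι] [DecidableEq ι]
    (W : Matrix κ ι ℝ) : ∃ (Z : Matrix ι ι ℝ) (S : Finset ι), Zᵀ * Z = 1 ∧
      Fintype.card ι ≤ S.card + Fintype.card κ ∧
      (∀ c, ∀ i ∈ S, (Zᵀ *ᵥ (Wᵀ *ᵥ c)) i = 0) ∧
      ∀ f, W *ᵥ f = 0 → ∀ i ∉ S, (Zᵀ *ᵥ f) i = 0 := by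
  classical
  obtain ⟨Z, d, hZ, -, h⟩ := exists_gram_eigen W
  have hZ' : Z * Zᵀ = 1 := mul_eq_one_comm.mp hZ
  have hdiag : (W * Z)ᵀ * (W * Z) = diagonal fun i => d i ^ 2 := by
    calc (W * Z)ᵀ * (W * Z) = Zᵀ * (Wᵀ * W) * Z := by
          simp only [transpose_mul, Matrix.mul_assoc]
      _ = (Zᵀ * Z) * diagonal (fun i => d i ^ 2) * (Zᵀ * Z) := by
          rw [h]; simp only [Matrix.mul_assoc]
      _ = _ := by simp [hZ]
  -- `Z` is an eigenbasis of `WᵀW` and `S` indexes its kernel, so the `S`-coordinates measure the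
  -- distance from the row space of `W`.
  refine ⟨Z, Finset.univ.filter fun i => d i = 0, hZ, ?_, ?_, ?_⟩
  · have h1 : (diagonal fun i => d i ^ 2).rank ≤ Fintype.card κ := by
      rw [← hdiag]
      exact (Matrix.rank_mul_le_right _ _).trans (Matrix.rank_le_card_height _)
    rw [Matrix.rank_diagonal] at h1
    have h2 : Fintype.card {i // d i ^ 2 ≠ 0} = (Finset.univ.filter fun i => ¬ d i = 0).card := by
      rw [Fintype.card_subtype]
      congr 1
      ext i
      simp
    rw [h2] at h1
    have h3 := Finset.card_filter_add_card_filter_not (s := (Finset.univ : Finset ι))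
      (fun i => d i = 0)
    rw [Finset.card_univ] at h3
    omega
  · intro c i hi
    have hi' : d i = 0 := (Finset.mem_filter.mp hi).2
    have h1 : (W * Z).col i ⬝ᵥ (W * Z).col i = 0 := by
      have : (W * Z).col i ⬝ᵥ (W * Z).col i = ((W * Z)ᵀ * (W * Z)) i i := rfl
      rw [this, hdiag, diagonal_apply_eq, hi']
      simp
    have h2 : (W * Z).col i = 0 := dotProduct_self_eq_zero.mp h1
    have h3 : (Zᵀ *ᵥ (Wᵀ *ᵥ c)) i = (W * Z).col i ⬝ᵥ c := by
      rw [mulVec_mulVec, ← transpose_mul]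
      rfl
    rw [h3, h2, zero_dotProduct]
  · intro f hf i hi
    have hi' : d i ≠ 0 := by simpa using hi
    have h1 : diagonal (fun i => d i ^ 2) *ᵥ (Zᵀ *ᵥ f) = 0 := by
      rw [← hdiag, mulVec_mulVec, Matrix.mul_assoc, Matrix.mul_assoc, hZ', Matrix.mul_one,
        ← mulVec_mulVec, hf, mulVec_zero]
    have h2 := congrFun h1 i
    rw [mulVec_diagonal] at h2
    exact (mul_eq_zero.mp h2).resolve_left (pow_ne_zero 2 hi')

/-- Only a lower bound on the size of `S` is known, as the other rows may be dependent; more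
coordinates only lower the inverse moment. -/
theorem lintegral_inv_residual_le {ι : Type*} [Fintype ι] [DecidableEq ι] {v : ℝ≥0} (hv : v ≠ 0)
    {Z : Matrix ι ι ℝ} (hZ : Zᵀ * Z = 1) {S : Finset ι} {m : ℕ} (hm : 2 < m) (hS : m ≤ S.card) :
    ∫⁻ x, (ENNReal.ofReal (∑ i ∈ S, (Zᵀ *ᵥ x) i ^ 2))⁻¹ ∂gaussianVector ι v
      ≤ ENNReal.ofReal (1 / (v * (m - 2))) := by
  have hZ' : Zᵀᵀ * Zᵀ = 1 := by rw [transpose_transpose, mul_eq_one_comm.mp hZ]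
  have h1 := gaussianVector_map_orthogonal v hZ'
  have h2 : ∫⁻ x, (ENNReal.ofReal (∑ i ∈ S, (Zᵀ *ᵥ x) i ^ 2))⁻¹ ∂gaussianVector ι v
      = ∫⁻ x, (ENNReal.ofReal (∑ i ∈ S, x i ^ 2))⁻¹ ∂gaussianVector ι v := by
    nth_rewrite 2 [← h1]
    rw [lintegral_map (by fun_prop) (measurable_mulVec _)]
  rw [h2, lintegral_inv_sum_sq hv S (hm.trans_le hS)]
  apply ENNReal.ofReal_le_ofReal
  have h3 : (2 : ℝ) < m := by exact_mod_cast hm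
  have h4 : (m : ℝ) ≤ S.card := by exact_mod_cast hS
  have h5 : (0 : ℝ) < v := by positivity
  have h6 : 0 < (m : ℝ) - 2 := by linarith
  gcongr

theorem sum_sq_rotate {ι : Type*} [Fintype ι] [DecidableEq ι] {Z : Matrix ι ι ℝ}
    (hZ : Zᵀ * Z = 1) (x y : ι → ℝ) : (Zᵀ *ᵥ x) ⬝ᵥ (Zᵀ *ᵥ y) = x ⬝ᵥ y := by
  rw [dotProduct_mulVec, ← mulVec_transpose, mulVec_mulVec, transpose_transpose,
    mul_eq_one_comm.mp hZ, one_mulVec]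

/-- The first `p` rows. -/
def head {n s : ℕ} (p : ℕ) (h : p ≤ n) (z : Fin n → Fin s → ℝ) : Matrix (Fin p) (Fin s) ℝ :=
  Matrix.of fun i => z (Fin.castLE h i)

variable {n p s : ℕ}

theorem continuous_head (h : p ≤ n) :
    Continuous (head p h : (Fin n → Fin s → ℝ) → Matrix (Fin p) (Fin s) ℝ) := by
  refine continuous_matrix fun i j => ?_
  simp only [head, of_apply]
  fun_prop

theorem measurable_det_head (h : p ≤ n) :
    Measurable fun z : Fin n → Fin s → ℝ => (head p h z * (head p h z)ᵀ).det :=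
  (((continuous_head h).matrix_mul (continuous_head h).matrix_transpose).matrix_det).measurable

theorem measurable_inv_head (h : p ≤ n) (i j : Fin p) :
    Measurable fun z : Fin n → Fin s → ℝ => (head p h z * (head p h z)ᵀ)⁻¹ i j := by
  simp only [Matrix.inv_def, Matrix.smul_apply, Ring.inverse_eq_inv', smul_eq_mul]
  refine (measurable_det_head h).inv.mul ?_
  exact (((continuous_head h).matrix_mul
    (continuous_head h).matrix_transpose).matrix_adjugate.matrix_elem i j).measurable

/-- The residual of a Gaussian row against the other rows. -/
theorem lintegral_inv_gram_update_le {v : ℝ≥0} (hv : v ≠ 0) (h : p ≤ n) (hps : p + 2 ≤ s)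
    (i : Fin p) (z : Fin n → Fin s → ℝ) :
    ∫⁻ x, ENNReal.ofReal ((head p h (Function.update z (Fin.castLE h i) x) *
        (head p h (Function.update z (Fin.castLE h i) x))ᵀ)⁻¹ i i) ∂gaussianVector (Fin s) v
      ≤ ENNReal.ofReal (1 / (v * ((s : ℝ) - p - 1))) := by
  set W : Matrix {k : Fin p // k ≠ i} (Fin s) ℝ := Matrix.of fun k => z (Fin.castLE h k) with hW
  obtain ⟨Z, S, hZ, hS, hrow, hker⟩ := exists_adapted_coordinates W
  have hp0 : 0 < p := i.pos
  have hcard : Fintype.card {k : Fin p // k ≠ i} = p - 1 := by simp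
  rw [hcard, Fintype.card_fin] at hS
  -- The other `p - 1` rows leave at least `m = s - p + 1` coordinates, so `m - 2 = s - p - 1`; `p +
  -- 2 ≤ s` ensures `m > 2`.
  refine (lintegral_mono fun x => ?_).trans
    ((lintegral_inv_residual_le hv hZ (S := S) (m := s - p + 1) (by omega) (by omega)).trans_eq ?_)
  · set N := head p h (Function.update z (Fin.castLE h i) x) with hN
    have hNi : N i = x := Function.update_self _ _ _
    have hNk : ∀ k : {k : Fin p // k ≠ i}, N k = W k := by
      intro k
      have : Fin.castLE h k.1 ≠ Fin.castLE h i := fun hc => k.2 (Fin.castLE_injective h hc)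
      simp only [hN, head, hW]
      exact Function.update_of_ne this _ _
    by_cases hdet : IsUnit (N * Nᵀ).det
    · set c : Fin p → ℝ := (N * Nᵀ)⁻¹ *ᵥ Pi.single i 1 with hc
      have hci : (N * Nᵀ)⁻¹ i i = c i := by simp [hc]
      -- `f` is the dual vector of row `i`: orthogonal to the other rows, with `x ⬝ᵥ f = 1`, and
      -- equal to `c i • x` modulo their span. In the coordinates of `Z` this reads `c i * ∑_S
      -- (Zᵀx)² = 1`.
      set f := Nᵀ *ᵥ c with hf
      have hNf : N *ᵥ f = Pi.single i 1 := by
        rw [hf, hc, mulVec_mulVec, mulVec_mulVec, Matrix.mul_nonsing_inv _ hdet, one_mulVec]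
      have hxf : x ⬝ᵥ f = 1 := by
        have := congrFun hNf i
        simp only [mulVec, Pi.single_eq_same] at this
        rwa [hNi] at this
      have hWf : W *ᵥ f = 0 := by
        ext k
        have := congrFun hNf k.1
        rw [Pi.single_eq_of_ne k.2] at this
        simp only [mulVec] at this ⊢
        rw [hNk] at this
        exact this
      have hfx : f = c i • x + Wᵀ *ᵥ (fun k => c k.1) := by
        ext j
        have h1 : f j = ∑ k, c k * N k j := by
          simp only [hf, mulVec, dotProduct, transpose_apply, mul_comm]
        rw [h1, ← Finset.add_sum_erase _ _ (Finset.mem_univ i), hNi]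
        simp only [Pi.add_apply, Pi.smul_apply, smul_eq_mul, mulVec, dotProduct, transpose_apply]
        congr 1
        rw [Finset.sum_subtype (p := fun k => k ≠ i) (Finset.univ.erase i) (by simp)
          (fun k => c k * N k j)]
        refine Finset.sum_congr rfl fun k _ => ?_
        rw [hNk, mul_comm]
      have hgS : ∀ j ∈ S, (Zᵀ *ᵥ f) j = c i * (Zᵀ *ᵥ x) j := by
        intro j hj
        rw [hfx, mulVec_add, Pi.add_apply, hrow _ j hj, add_zero, mulVec_smul, Pi.smul_apply,
          smul_eq_mul]
      have h1 : c i * ∑ j ∈ S, (Zᵀ *ᵥ x) j ^ 2 = 1 := by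
        rw [← hxf, ← sum_sq_rotate hZ x f, dotProduct, Finset.mul_sum,
          ← Finset.sum_subset (Finset.subset_univ S)
            (fun j _ hj => by rw [hker f hWf j hj, mul_zero])]
        refine Finset.sum_congr rfl fun j hj => ?_
        rw [hgS j hj]
        ring
      have h2 : 0 ≤ ∑ j ∈ S, (Zᵀ *ᵥ x) j ^ 2 := Finset.sum_nonneg fun _ _ => sq_nonneg _
      have h3 : 0 < ∑ j ∈ S, (Zᵀ *ᵥ x) j ^ 2 := by
        refine h2.lt_of_ne fun h0 => ?_
        rw [← h0, mul_zero] at h1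
        exact zero_ne_one h1
      rw [hci, ← ENNReal.ofReal_inv_of_pos h3, eq_inv_of_mul_eq_one_left h1]
    -- The inverse of a singular matrix is `0` by convention, so the bound is trivial here.
    · rw [Matrix.nonsing_inv_apply_not_isUnit _ hdet]
      simp
  · congr 3
    push_cast [Nat.cast_sub (by omega : p ≤ s)]
    ring

/-- The inverse squared residual has finite mean, hence is almost surely finite. So the new row
almost surely lies outside the span of the earlier ones. -/
theorem ae_update_isUnit_det {v : ℝ≥0} (hv : v ≠ 0) {q : ℕ} (hq : q + 1 ≤ n) (hqs : q + 3 ≤ s)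
    (z : Fin n → Fin s → ℝ) (hz : IsUnit (head q (by omega) z * (head q (by omega) z)ᵀ).det) :
    ∀ᵐ x ∂gaussianVector (Fin s) v,
      IsUnit (head (q + 1) hq (Function.update z ⟨q, hq⟩ x) *
        (head (q + 1) hq (Function.update z ⟨q, hq⟩ x))ᵀ).det := by
  set W := head q (by omega) z with hW
  obtain ⟨Z, S, hZ, hS, hrow, hker⟩ := exists_adapted_coordinates W
  rw [Fintype.card_fin, Fintype.card_fin] at hS
  have h1 := lintegral_inv_residual_le hv hZ (m := s - q) (S := S) (by omega) (by omega)
  have h2 := ae_lt_top (μ := gaussianVector (Fin s) v)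
    (f := fun x => (ENNReal.ofReal (∑ i ∈ S, (Zᵀ *ᵥ x) i ^ 2))⁻¹)
    (by have := measurable_mulVec Zᵀ; fun_prop) (h1.trans_lt ENNReal.ofReal_lt_top).ne
  filter_upwards [h2] with x hx
  rw [isUnit_det_mul_transpose_iff] at hz ⊢
  intro c hc
  set N := head (q + 1) hq (Function.update z ⟨q, hq⟩ x) with hN
  have hlast : N (Fin.last q) = x := Function.update_self _ _ _
  have hinit : ∀ k : Fin q, N k.castSucc = W k := by
    intro k
    have : Fin.castLE hq k.castSucc ≠ ⟨q, hq⟩ := by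
      intro hcon
      have := congrArg Fin.val hcon
      simp at this
      omega
    simp only [hN, head, hW]
    exact Function.update_of_ne this _ _
  have h3 : Wᵀ *ᵥ (fun k => c k.castSucc) + c (Fin.last q) • x = 0 := by
    rw [← hc]
    ext j
    simp only [mulVec, dotProduct, transpose_apply, Pi.add_apply, Pi.smul_apply, smul_eq_mul]
    rw [Fin.sum_univ_castSucc, hlast, mul_comm (x j)]
    congr 1
    refine Finset.sum_congr rfl fun k _ => ?_
    rw [hinit]
  have h4 : c (Fin.last q) = 0 := by
    by_contra h0
    have h5 : x = Wᵀ *ᵥ (fun k => -(c (Fin.last q))⁻¹ * c k.castSucc) := by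
      have h6 : (fun k : Fin q => -(c (Fin.last q))⁻¹ * c k.castSucc)
          = (-(c (Fin.last q))⁻¹) • fun k => c k.castSucc := rfl
      rw [h6, mulVec_smul, eq_neg_of_add_eq_zero_left h3, smul_neg, neg_smul, neg_neg, smul_smul,
        inv_mul_cancel₀ h0, one_smul]
    have h7 : ∑ i ∈ S, (Zᵀ *ᵥ x) i ^ 2 = 0 := by
      refine Finset.sum_eq_zero fun i hi => ?_
      rw [h5, hrow _ i hi]
      simp
    rw [h7] at hx
    simp at hx
  rw [h4, zero_smul, add_zero] at h3
  have h8 := hz _ h3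
  ext k
  refine Fin.lastCases h4 (fun k => ?_) k
  exact congrFun h8 k

theorem ae_isUnit_det_head {v : ℝ≥0} (hv : v ≠ 0) (h : p ≤ n) (hps : p + 2 ≤ s) :
    ∀ᵐ z ∂gaussianRows n s v, IsUnit (head p h z * (head p h z)ᵀ).det := by
  induction p with
  | zero => exact ae_of_all _ fun z => by simp
  | succ q ih =>
    have ih' := ih (by omega) (by omega)
    set bad : Set (Fin n → Fin s → ℝ) :=
      {z | IsUnit (head q (by omega) z * (head q (by omega) z)ᵀ).det ∧
        ¬ IsUnit (head (q + 1) h z * (head (q + 1) h z)ᵀ).det} with hbad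
    have hmeas : MeasurableSet bad := by
      simp only [hbad, isUnit_iff_ne_zero, ne_eq, not_not]
      exact ((measurable_det_head _) (measurableSet_singleton 0)).compl.inter
        ((measurable_det_head _) (measurableSet_singleton 0))
    have h0 : gaussianRows n s v bad = 0 := by
      rw [← lintegral_indicator_one hmeas]
      unfold gaussianRows
      -- Resampling row `q` does not touch the first `q` rows, so for fixed `z` either `bad` is
      -- never hit or `ae_update_isUnit_det` applies.
      rw [lintegral_pi_resample _ (measurable_one.indicator hmeas) ⟨q, h⟩, lintegral_eq_zero_iff']
      · refine ae_of_all _ fun z => ?_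
        have hhead : ∀ x, head q (by omega) (Function.update z ⟨q, h⟩ x) = head q (by omega) z := by
          intro x
          ext k j
          have : Fin.castLE (by omega : q ≤ n) k ≠ ⟨q, h⟩ := by
            intro hcon
            have := congrArg Fin.val hcon
            simp at this
            omega
          simp only [head, of_apply, Function.update_of_ne this]
        by_cases hz : IsUnit (head q (by omega) z * (head q (by omega) z)ᵀ).det
        · refine (lintegral_congr_ae (g := fun _ => 0) ?_).trans (by simp)
          filter_upwards [ae_update_isUnit_det hv h (by omega) z hz] with x hx
          exact Set.indicator_of_notMem (fun hb => hb.2 hx) _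
        · refine (lintegral_congr (g := fun _ => 0) fun x => ?_).trans (by simp)
          exact Set.indicator_of_notMem (fun hb => hz (by have := hb.1; rwa [hhead] at this)) _
      · refine Measurable.aemeasurable (Measurable.lintegral_prod_right'
          (f := fun q' : (Fin n → Fin s → ℝ) × (Fin s → ℝ) =>
            bad.indicator 1 (Function.update q'.1 ⟨q, h⟩ q'.2)) ?_)
        refine (measurable_one.indicator hmeas).comp (measurable_pi_lambda _ fun j => ?_)
        by_cases hj : j = ⟨q, h⟩
        · subst hj
          simpa using measurable_snd
        · simp only [Function.update_of_ne hj]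
          fun_prop
    have h1 : ∀ᵐ z ∂gaussianRows n s v, z ∉ bad := measure_eq_zero_iff_ae_notMem.mp h0
    filter_upwards [ih', h1] with z hz1 hz2
    by_contra hcon
    exact hz2 ⟨hz1, hcon⟩

end Rank

/-! ### The mean of the tail energy. -/

theorem lintegral_sq_dotProduct_gaussianVector {ι : Type*} [Fintype ι] (v : ℝ≥0) (f : ι → ℝ) :
    ∫⁻ x, ENNReal.ofReal ((x ⬝ᵥ f) ^ 2) ∂gaussianVector ι v = ENNReal.ofReal (v * (f ⬝ᵥ f)) := by
  have hL : ∀ i, MemLp (fun x : ℝ => f i * x) 2 (gaussianReal 0 v) := fun i =>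
    (memLp_id_gaussianReal 2).const_mul (f i)
  have hsum : (∑ i, fun x : ι → ℝ => f i * x i) = fun x => x ⬝ᵥ f := by
    funext x
    simp [dotProduct, mul_comm]
  have hLp : ∀ i, MemLp (fun x : ι → ℝ => f i * x i) 2 (gaussianVector ι v) := fun i =>
    (hL i).comp_measurePreserving (measurePreserving_eval (fun _ : ι => gaussianReal 0 v) i)
  have hvar : Var[fun x : ι → ℝ => x ⬝ᵥ f; gaussianVector ι v] = v * (f ⬝ᵥ f) := by
    rw [← hsum]
    unfold gaussianVector
    rw [variance_sum_pi hL]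
    have h1 : ∀ i, Var[fun x : ℝ => f i * x; gaussianReal 0 v] = v * (f i * f i) := by
      intro i
      rw [variance_const_mul, variance_fun_id_gaussianReal]
      ring
    rw [Finset.sum_congr rfl fun i _ => h1 i, dotProduct, Finset.mul_sum]
  have hmean : ∫ x, x ⬝ᵥ f ∂gaussianVector ι v = 0 := by
    simp only [dotProduct]
    rw [integral_finsetSum]
    · refine Finset.sum_eq_zero fun i _ => ?_
      rw [integral_mul_const]
      have h1 : ∫ x : ι → ℝ, x i ∂gaussianVector ι v = ∫ y, y ∂gaussianReal 0 v :=
        integral_comp_eval (μ := fun _ : ι => gaussianReal 0 v) (i := i) (f := fun y => y)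
          (by fun_prop)
      rw [h1, integral_id_gaussianReal, zero_mul]
    · intro i _
      have := (hLp i).integrable one_le_two
      simpa [mul_comm] using this
  have hLp' : MemLp (fun x : ι → ℝ => x ⬝ᵥ f) 2 (gaussianVector ι v) := by
    rw [← hsum]
    exact memLp_finsetSum' _ fun i _ => hLp i
  have h2 := hLp'.ofReal_variance_eq
  rw [hvar, evariance_eq_lintegral_ofReal, hmean] at h2
  simpa using h2.symm

variable {n p s r : ℕ}

/-- The coefficients `[1; 0; B]` of the sketch. -/
noncomputable def sketchCoeff (hrp : r ≤ p) (h : p ≤ n) (z : Fin n → Fin s → ℝ) :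
    Matrix (Fin n) (Fin r) ℝ :=
  Matrix.of z * dualFrame r hrp (head p h z)

theorem sketchCoeff_apply_head (hrp : r ≤ p) (h : p ≤ n) {z : Fin n → Fin s → ℝ}
    (hz : IsUnit (head p h z * (head p h z)ᵀ).det) (i : Fin n) (a : Fin r) (hi : i.val < p) :
    sketchCoeff hrp h z i a = if i.val = a.val then 1 else 0 :=
  mul_dualFrame hrp hz ⟨i, hi⟩ a

theorem dualFrame_dotProduct_self (hrp : r ≤ p) (N : Matrix (Fin p) (Fin s) ℝ) (a : Fin r) :
    (fun j => dualFrame r hrp N j a) ⬝ᵥ (fun j => dualFrame r hrp N j a)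
      = (N * Nᵀ)⁻¹ (Fin.castLE hrp a) (Fin.castLE hrp a) := by
  have h1 : (fun j => dualFrame r hrp N j a) ⬝ᵥ (fun j => dualFrame r hrp N j a)
      = ((Nᵀ * (N * Nᵀ)⁻¹)ᵀ * (Nᵀ * (N * Nᵀ)⁻¹)) (Fin.castLE hrp a) (Fin.castLE hrp a) := rfl
  have h2 : (Nᵀ * (N * Nᵀ)⁻¹)ᵀ * (Nᵀ * (N * Nᵀ)⁻¹) = (N * Nᵀ)⁻¹ := by
    by_cases hN : IsUnit (N * Nᵀ).det
    · calc _ = (N * Nᵀ)⁻¹ * ((N * Nᵀ) * (N * Nᵀ)⁻¹) := by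
            simp only [transpose_mul, transpose_nonsing_inv, transpose_transpose,
              Matrix.mul_assoc]
        _ = _ := by rw [Matrix.mul_nonsing_inv _ hN, Matrix.mul_one]
    · rw [Matrix.nonsing_inv_apply_not_isUnit _ hN]
      simp
  rw [h1, h2]

theorem measurable_dualFrame_head (hrp : r ≤ p) (h : p ≤ n) (j : Fin s) (a : Fin r) :
    Measurable fun z : Fin n → Fin s → ℝ => dualFrame r hrp (head p h z) j a := by
  unfold dualFrame
  simp only [submatrix_apply, Matrix.mul_apply, transpose_apply]
  refine Finset.measurable_sum _ fun k _ => ?_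
  refine Measurable.mul ?_ (measurable_inv_head h _ _)
  simp only [head, of_apply, id]
  fun_prop

theorem measurable_sketchCoeff (hrp : r ≤ p) (h : p ≤ n) (i : Fin n) (a : Fin r) :
    Measurable fun z : Fin n → Fin s → ℝ => sketchCoeff hrp h z i a := by
  unfold sketchCoeff
  simp only [Matrix.mul_apply, of_apply]
  refine Finset.measurable_sum _ fun k _ => ?_
  exact Measurable.mul (by fun_prop) (measurable_dualFrame_head hrp h k a)

theorem measurable_tailEnergy (hrp : r ≤ p) (h : p ≤ n) (l : Fin n → ℝ) :
    Measurable fun z : Fin n → Fin s → ℝ => tailEnergy p l (sketchCoeff hrp h z) := by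
  unfold tailEnergy
  refine Finset.measurable_sum _ fun i _ => ?_
  split_ifs
  · exact measurable_const
  · refine measurable_const.mul (Finset.measurable_sum _ fun a _ => ?_)
    exact (measurable_sketchCoeff hrp h i a).pow_const 2

/-- Two resamplings: row `i ≥ p`, independent of the head, contributes `v` times a diagonal entry of
the inverse Gram matrix; then row `a` bounds the mean of that entry, and `v` cancels. -/
theorem lintegral_sq_sketchCoeff_le {v : ℝ≥0} (hv : v ≠ 0) (hrp : r ≤ p) (h : p ≤ n)
    (hps : p + 2 ≤ s) (i : Fin n) (hi : p ≤ i.val) (a : Fin r) :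
    ∫⁻ z, ENNReal.ofReal (sketchCoeff hrp h z i a ^ 2) ∂gaussianRows n s v
      ≤ ENNReal.ofReal (1 / ((s : ℝ) - p - 1)) := by
  have hv' : (0 : ℝ) < v := by positivity
  have hps' : (0 : ℝ) < (s : ℝ) - p - 1 := by
    have : (p : ℝ) + 2 ≤ s := by exact_mod_cast hps
    linarith
  have hm := ((measurable_sketchCoeff (s := s) hrp h i a).pow_const 2).ennreal_ofReal
  have h1 : ∀ z : Fin n → Fin s → ℝ,
      ∫⁻ x, ENNReal.ofReal (sketchCoeff hrp h (Function.update z i x) i a ^ 2)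
        ∂gaussianVector (Fin s) v
      = ENNReal.ofReal v * ENNReal.ofReal
        ((head p h z * (head p h z)ᵀ)⁻¹ (Fin.castLE hrp a) (Fin.castLE hrp a)) := by
    intro z
    have hhead : ∀ x, head p h (Function.update z i x) = head p h z := by
      intro x
      ext k j
      have : Fin.castLE h k ≠ i := by
        intro hcon
        have := congrArg Fin.val hcon
        simp at this
        omega
      simp only [head, of_apply, Function.update_of_ne this]
    rw [← ENNReal.ofReal_mul hv'.le, ← dualFrame_dotProduct_self,
      ← lintegral_sq_dotProduct_gaussianVector]
    refine lintegral_congr fun x => ?_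
    have : sketchCoeff hrp h (Function.update z i x) i a
        = Function.update z i x i ⬝ᵥ fun j => dualFrame r hrp (head p h (Function.update z i x)) j a :=
      rfl
    rw [this, hhead, Function.update_self]
  have h2 : ∫⁻ z : Fin n → Fin s → ℝ, ENNReal.ofReal
        ((head p h z * (head p h z)ᵀ)⁻¹ (Fin.castLE hrp a) (Fin.castLE hrp a)) ∂gaussianRows n s v
      ≤ ENNReal.ofReal (1 / (v * ((s : ℝ) - p - 1))) := by
    unfold gaussianRows
    rw [lintegral_pi_resample _ (measurable_inv_head h _ _).ennreal_ofReal
      (Fin.castLE h (Fin.castLE hrp a))]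
    refine (lintegral_mono fun z => lintegral_inv_gram_update_le hv h hps _ z).trans_eq ?_
    simp
  have h3 : ∫⁻ z, ENNReal.ofReal (sketchCoeff hrp h z i a ^ 2) ∂gaussianRows n s v
      = ∫⁻ z, (∫⁻ x, ENNReal.ofReal (sketchCoeff hrp h (Function.update z i x) i a ^ 2)
        ∂gaussianVector (Fin s) v) ∂gaussianRows n s v := lintegral_pi_resample _ hm i
  rw [h3]
  simp_rw [h1]
  rw [lintegral_const_mul _ (measurable_inv_head h _ _).ennreal_ofReal]
  calc _ ≤ ENNReal.ofReal v * ENNReal.ofReal (1 / (v * ((s : ℝ) - p - 1))) := by gcongr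
    _ = _ := by
      rw [← ENNReal.ofReal_mul hv'.le]
      congr 1
      field_simp

theorem lintegral_tailEnergy_le {v : ℝ≥0} (hv : v ≠ 0) (hrp : r ≤ p) (h : p ≤ n)
    (hps : p + 2 ≤ s) (l : Fin n → ℝ) :
    ∫⁻ z, ENNReal.ofReal (tailEnergy p l (sketchCoeff hrp h z)) ∂gaussianRows n s v
      ≤ ENNReal.ofReal ((r / ((s : ℝ) - p - 1)) * ∑ i : Fin n, if i.val < p then 0 else |l i|) := by
  have hps' : (0 : ℝ) < (s : ℝ) - p - 1 := by
    have : (p : ℝ) + 2 ≤ s := by exact_mod_cast hps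
    linarith
  have hmK := fun i a => ((measurable_sketchCoeff (s := s) hrp h i a).pow_const 2).ennreal_ofReal
  have h1 : ∀ z : Fin n → Fin s → ℝ, ENNReal.ofReal (tailEnergy p l (sketchCoeff hrp h z))
      = ∑ i : Fin n, if i.val < p then 0 else
        ENNReal.ofReal |l i| * ∑ a, ENNReal.ofReal (sketchCoeff hrp h z i a ^ 2) := by
    intro z
    unfold tailEnergy
    rw [ENNReal.ofReal_sum_of_nonneg]
    · refine Finset.sum_congr rfl fun i _ => ?_
      split_ifs
      · simp
      · rw [ENNReal.ofReal_mul (abs_nonneg _), ENNReal.ofReal_sum_of_nonneg]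
        exact fun _ _ => sq_nonneg _
    · intro i _
      split_ifs
      · exact le_rfl
      · exact mul_nonneg (abs_nonneg _) (Finset.sum_nonneg fun _ _ => sq_nonneg _)
  simp_rw [h1]
  rw [lintegral_finsetSum, Finset.mul_sum, ENNReal.ofReal_sum_of_nonneg]
  · refine Finset.sum_le_sum fun i _ => ?_
    split_ifs with hi
    · simp
    · rw [lintegral_const_mul _ (Finset.measurable_sum _ fun a _ => hmK i a),
        lintegral_finsetSum _ fun a _ => hmK i a]
      calc _ ≤ ENNReal.ofReal |l i| * ∑ a : Fin r, ENNReal.ofReal (1 / ((s : ℝ) - p - 1)) := by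
            gcongr with a
            exact lintegral_sq_sketchCoeff_le hv hrp h hps i (not_lt.mp hi) a
        _ = _ := by
            rw [← ENNReal.ofReal_sum_of_nonneg fun _ _ => by positivity,
              ← ENNReal.ofReal_mul (abs_nonneg _)]
            congr 1
            simp
            ring
  · intro i _
    split_ifs
    · simp
    · positivity
  · intro i _
    split_ifs
    · exact measurable_const
    · exact measurable_const.mul (Finset.measurable_sum _ fun a _ => hmK i a)

/-! ### Positivity of the event, and conditioning on it. -/

theorem tailEnergy_smul (c : ℝ) (l : Fin n → ℝ) (K : Matrix (Fin n) (Fin r) ℝ) :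
    tailEnergy p l (c • K) = c ^ 2 * tailEnergy p l K := by
  unfold tailEnergy
  rw [Finset.mul_sum]
  refine Finset.sum_congr rfl fun i _ => ?_
  split_ifs
  · simp
  · simp only [Matrix.smul_apply, smul_eq_mul, mul_pow, ← Finset.mul_sum]
    ring

theorem continuous_tailEnergy (l : Fin n → ℝ) :
    Continuous (tailEnergy p l : Matrix (Fin n) (Fin r) ℝ → ℝ) := by
  unfold tailEnergy
  refine continuous_finsetSum _ fun i _ => ?_
  split_ifs <;> fun_prop

theorem gaussianRows_isOpenPosMeasure {v : ℝ≥0} (hv : v ≠ 0) :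
    (gaussianRows n s v).IsOpenPosMeasure := by
  have : (gaussianReal 0 v).IsOpenPosMeasure :=
    (gaussianReal_absolutelyContinuous' 0 hv).isOpenPosMeasure
  have : (gaussianVector (Fin s) v).IsOpenPosMeasure :=
    Measure.pi.isOpenPosMeasure fun _ : Fin s => gaussianReal 0 v
  exact Measure.pi.isOpenPosMeasure fun _ : Fin n => gaussianVector (Fin s) v

/-- The event contains a nonempty open set, which the Gaussian law charges. Replacing the inverse by
the adjugate clears the determinant and yields conditions continuous in `z`. -/
theorem gaussianRows_tailEnergy_le_pos {v : ℝ≥0} (hv : v ≠ 0) (hrp : r ≤ p) (h : p ≤ n)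
    (hps : p ≤ s) (l : Fin n → ℝ) {t : ℝ} (ht : 0 < t) :
    0 < gaussianRows n s v {z | tailEnergy p l (sketchCoeff hrp h z) ≤ t} := by
  have := gaussianRows_isOpenPosMeasure (n := n) (s := s) hv
  set G : (Fin n → Fin s → ℝ) → Matrix (Fin p) (Fin p) ℝ :=
    fun z => head p h z * (head p h z)ᵀ with hG
  set K' : (Fin n → Fin s → ℝ) → Matrix (Fin n) (Fin r) ℝ :=
    fun z => (Matrix.of z * ((head p h z)ᵀ * (G z).adjugate)).submatrix id (Fin.castLE hrp) with hK'
  have hcG : Continuous G := (continuous_head h).matrix_mul (continuous_head h).matrix_transpose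
  have hof : Continuous fun z : Fin n → Fin s → ℝ => (Matrix.of z : Matrix (Fin n) (Fin s) ℝ) :=
    continuous_matrix fun i j => by simp only [of_apply]; fun_prop
  have hcK' : Continuous K' :=
    (hof.matrix_mul ((continuous_head h).matrix_transpose.matrix_mul
      hcG.matrix_adjugate)).matrix_submatrix _ _
  set O : Set (Fin n → Fin s → ℝ) :=
    {z | (G z).det ≠ 0} ∩ {z | tailEnergy p l (K' z) < t * (G z).det ^ 2} with hO
  have hOopen : IsOpen O := by
    refine IsOpen.inter (isOpen_ne_fun hcG.matrix_det continuous_const) ?_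
    exact isOpen_lt ((continuous_tailEnergy l).comp hcK')
      (continuous_const.mul (hcG.matrix_det.pow 2))
  have hOne : O.Nonempty := by
    -- Orthonormal head rows and zero tail rows: the Gram matrix is `1` and `B = 0`.
    set z₀ : Fin n → Fin s → ℝ := fun i j => if i.val < p ∧ i.val = j.val then 1 else 0 with hz₀
    have hG1 : G z₀ = 1 := by
      ext i k
      rw [hG]
      simp only [Matrix.mul_apply, transpose_apply, head, of_apply, hz₀, Fin.val_castLE, i.2, k.2,
        true_and, Matrix.one_apply]
      rw [Finset.sum_eq_single (⟨i, by omega⟩ : Fin s)]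
      · simp [Fin.ext_iff, eq_comm]
      · intro j _ hj
        have : i.val ≠ j.val := fun hc => hj (Fin.ext hc.symm)
        simp [this]
      · simp
    refine ⟨z₀, ?_, ?_⟩
    · simp [hG1]
    · have : tailEnergy p l (K' z₀) = 0 := by
        unfold tailEnergy
        refine Finset.sum_eq_zero fun i _ => ?_
        split_ifs with hi
        · rfl
        · have h0 : ∀ a, K' z₀ i a = 0 := by
            intro a
            simp only [hK', submatrix_apply, id]
            rw [Matrix.mul_apply]
            refine Finset.sum_eq_zero fun j _ => ?_
            simp [hz₀, hi]
          simp [h0]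
      simp [this, hG1, ht]
  refine (hOopen.measure_pos _ hOne).trans_le (measure_mono ?_)
  rintro z ⟨hz1, hz2⟩
  have h1 : sketchCoeff hrp h z = ((G z).det)⁻¹ • K' z := by
    ext i a
    simp only [sketchCoeff, dualFrame, hK', Matrix.inv_def, Ring.inverse_eq_inv', Matrix.mul_smul,
      Matrix.smul_apply, Matrix.mul_apply, submatrix_apply, smul_eq_mul, Finset.mul_sum, id, hG]
    refine Finset.sum_congr rfl fun j _ => Finset.sum_congr rfl fun k _ => ?_
    ring
  simp only [Set.mem_ofPred_eq] at hz1 hz2 ⊢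
  rw [h1, tailEnergy_smul, inv_pow, inv_mul_le_iff₀ (by positivity)]
  linarith

/-- Conditioning on a lower level set does not increase the mean. -/
theorem integral_cond_le_integral {Ω : Type*} [MeasurableSpace Ω] {μ : Measure Ω}
    [IsProbabilityMeasure μ] {y : Ω → ℝ} (hy : Integrable y μ) {S : Set Ω}
    (hS : NullMeasurableSet S μ) (hS0 : 0 < μ S) {t : ℝ} (hle : ∀ᵐ ω ∂μ, ω ∈ S → y ω ≤ t)
    (hge : ∀ᵐ ω ∂μ, ω ∉ S → t ≤ y ω) : ∫ ω, y ω ∂μ[|S] ≤ ∫ ω, y ω ∂μ := by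
  have hq : 0 < μ.real S := ENNReal.toReal_pos hS0.ne' (measure_ne_top _ _)
  have hq1 : μ.real S ≤ 1 := measureReal_le_one
  have ha : ∫ ω in S, y ω ∂μ ≤ μ.real S * t := by
    calc _ ≤ ∫ _ in S, t ∂μ :=
          integral_mono_ae hy.restrict (integrable_const t) ((ae_restrict_iff'₀ hS).mpr hle)
      _ = _ := by simp
  have hb : (1 - μ.real S) * t ≤ ∫ ω in Sᶜ, y ω ∂μ := by
    calc (1 - μ.real S) * t = ∫ _ in Sᶜ, t ∂μ := by
          simp [probReal_compl_eq_one_sub₀ hS]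
      _ ≤ _ := integral_mono_ae (integrable_const t) hy.restrict
          ((ae_restrict_iff'₀ hS.compl).mpr hge)
  have h3 : (μ S).toReal = μ.real S := rfl
  rw [← integral_add_compl₀ hS hy, ProbabilityTheory.cond, integral_smul_measure,
    ENNReal.toReal_inv, smul_eq_mul, h3, inv_mul_le_iff₀ hq]
  -- With `q = μ.real S`, `ha` and `hb` give `(1 - q) ∫_S y ≤ q(1 - q)t ≤ q ∫_{Sᶜ} y`, which
  -- rearranges to the goal.
  have h1 := mul_le_mul_of_nonneg_left hb hq.le
  have h2 := mul_le_mul_of_nonneg_left ha (sub_nonneg.mpr hq1)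
  nlinarith

/-! ### Assembly: the error formula, its measurability and the constant. -/

variable {n p s r : ℕ}

theorem thinQR_factor {q : ℕ} {X₁ : Matrix (Fin r) (Fin s) ℝ} {Q : Matrix (Fin s) (Fin q) ℝ}
    {Qh : Matrix (Fin q) (Fin r) ℝ} {Rh : Matrix (Fin r) (Fin r) ℝ} (hQ : Qᵀ * Q = 1)
    (hQR : IsThinQR (pinv (X₁ * Q)) Qh Rh) :
    (Q * Qh)ᵀ * (Q * Qh) = 1 ∧ Q * pinv (X₁ * Q) = Q * Qh * Rh := by
  constructor
  · rw [transpose_mul, Matrix.mul_assoc, ← Matrix.mul_assoc Qᵀ, hQ, Matrix.one_mul,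
      hQR.orthonormal]
  · rw [hQR.eq, Matrix.mul_assoc]

theorem projector_of_orthonormal {U : Matrix (Fin s) (Fin r) ℝ} (hU : Uᵀ * U = 1) :
    U * Uᵀ * (U * Uᵀ) = U * Uᵀ ∧ (U * Uᵀ)ᵀ = U * Uᵀ ∧ (U * Uᵀ).rank = r := by
  refine ⟨?_, ?_, ?_⟩
  · rw [Matrix.mul_assoc, ← Matrix.mul_assoc Uᵀ, hU, Matrix.one_mul]
  · rw [transpose_mul, transpose_transpose]
  · rw [rank_self_mul_transpose, ← rank_transpose_mul_self, hU, rank_one, Fintype.card_fin]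

/-- The error of the sketch in the eigenbasis. -/
noncomputable def sketchError (l : Fin n → ℝ) (K : Matrix (Fin n) (Fin r) ℝ) :
    Matrix (Fin n) (Fin n) ℝ :=
  diagonal l - diagonal l * K * (Kᵀ * diagonal l * K)⁻¹ * (Kᵀ * diagonal l)

theorem nystrom_error_eq {A V : Matrix (Fin n) (Fin n) ℝ} {l : Fin n → ℝ}
    (hA : A = V * diagonal l * Vᵀ) {X : Matrix (Fin n) (Fin s) ℝ} {U F : Matrix (Fin s) (Fin r) ℝ}
    {R : Matrix (Fin r) (Fin r) ℝ} (hU : Uᵀ * U = 1) (hF : F = U * R)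
    {K : Matrix (Fin n) (Fin r) ℝ} (hK : K = Vᵀ * X * F)
    (hM : IsUnit (Kᵀ * diagonal l * K).det) :
    A - A * X * pinv (U * Uᵀ * Xᵀ * A * X * (U * Uᵀ)) * Xᵀ * A
      = V * sketchError l K * Vᵀ := by
  have h1 : Fᵀ * (Xᵀ * A * X) * F = Kᵀ * diagonal l * K := by
    rw [hA, hK]
    simp only [transpose_mul, transpose_transpose, Matrix.mul_assoc]
  have h2 : U * Uᵀ * Xᵀ * A * X * (U * Uᵀ) = U * Uᵀ * (Xᵀ * A * X) * (U * Uᵀ) := by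
    simp only [Matrix.mul_assoc]
  rw [h2, pinv_projected hU hF (by rwa [h1]), h1]
  have h3 : A * X * F = V * (diagonal l * K) := by
    rw [hA, hK]
    simp only [Matrix.mul_assoc]
  have h4 : Fᵀ * Xᵀ * A = Kᵀ * diagonal l * Vᵀ := by
    rw [hA, hK]
    simp only [transpose_mul, transpose_transpose, Matrix.mul_assoc]
  calc _ = A - (A * X * F) * (Kᵀ * diagonal l * K)⁻¹ * (Fᵀ * Xᵀ * A) := by
        simp only [Matrix.mul_assoc]
    _ = _ := by
        rw [h3, h4, hA, sketchError, Matrix.mul_sub, Matrix.sub_mul]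
        simp only [Matrix.mul_assoc]

theorem measurable_nuclearNorm_sketchError {α : Type*} [MeasurableSpace α] (l : Fin n → ℝ)
    {K : α → Matrix (Fin n) (Fin r) ℝ} (hK : ∀ i a, Measurable fun z => K z i a) :
    Measurable fun z => nuclearNorm (sketchError l (K z)) := by
  have hmul : ∀ {ι κ τ : Type} [Fintype κ] (M : α → Matrix ι κ ℝ) (N : α → Matrix κ τ ℝ),
      (∀ i j, Measurable fun z => M z i j) → (∀ i j, Measurable fun z => N z i j) →
      ∀ i j, Measurable fun z => (M z * N z) i j := by
    intro ι κ τ _ M N hM hN i j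
    simp only [Matrix.mul_apply]
    exact Finset.measurable_sum _ fun k _ => (hM i k).mul (hN k j)
  have hKT : ∀ a i, Measurable fun z => (K z)ᵀ a i := fun a i => hK i a
  have hΛ : ∀ i j, Measurable fun _ : α => diagonal l i j := fun i j => measurable_const
  have hG := hmul (fun z => (K z)ᵀ * diagonal l) K (hmul _ (fun _ => diagonal l) hKT hΛ) hK
  have hinv : ∀ a b, Measurable fun z => ((K z)ᵀ * diagonal l * K z)⁻¹ a b := by
    intro a b
    have hc : Measurable fun M : Fin r → Fin r → ℝ =>
        (Matrix.of M).det⁻¹ * (Matrix.of M).adjugate a b := by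
      have hof : Continuous fun M : Fin r → Fin r → ℝ => (Matrix.of M : Matrix (Fin r) (Fin r) ℝ) :=
        continuous_matrix fun i j => by simp only [of_apply]; fun_prop
      exact hof.matrix_det.measurable.inv.mul (hof.matrix_adjugate.matrix_elem a b).measurable
    simp only [Matrix.inv_def, Ring.inverse_eq_inv', Matrix.smul_apply, smul_eq_mul]
    exact hc.comp (measurable_pi_lambda _ fun i => measurable_pi_lambda _ fun j => hG i j)
  have hE : ∀ i j, Measurable fun z => sketchError l (K z) i j := by
    intro i j
    unfold sketchError
    simp only [Matrix.sub_apply]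
    refine measurable_const.sub ?_
    exact hmul _ (fun z => (K z)ᵀ * diagonal l)
      (hmul _ (fun z => ((K z)ᵀ * diagonal l * K z)⁻¹) (hmul (fun _ => diagonal l) K hΛ hK) hinv)
      (hmul _ (fun _ => diagonal l) hKT hΛ) i j
  have hof : Continuous fun M : Fin n → Fin n → ℝ => (Matrix.of M : Matrix (Fin n) (Fin n) ℝ) :=
    continuous_matrix fun i j => by simp only [of_apply]; fun_prop
  exact (continuous_nuclearNorm.comp hof).measurable.comp
    (measurable_pi_lambda _ fun i => measurable_pi_lambda _ fun j => hE i j)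

/-- Since `b/√b = √b`, the left side is exactly `a + 2b(1 + ρ + 2/√b)L`; the factor `√r ≥ 1` in `ε`
is slack. If `a = 0` then `L = 0`, and `L / a` is `0` as intended. -/
theorem error_constant_le {r : ℕ} {a L ρ b ε : ℝ} (hr : 0 < r) (hL : 0 ≤ L) (hLa : L ≤ a)
    (hρ : 0 ≤ ρ) (hb : 0 < b) (hε : ε = 2 * b * √(r : ℝ) * (1 + ρ + 2 / √b) * (L / a)) :
    a + 2 * √b * L + (2 + 2 * ρ + 2 / √b) * (b * L) ≤ (1 + ε) * a := by
  have hsb : 0 < √b := Real.sqrt_pos.mpr hb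
  have hεa : ε * a = 2 * b * √(r : ℝ) * (1 + ρ + 2 / √b) * L := by
    rcases (hL.trans hLa).eq_or_lt with h | h
    · have : L = 0 := le_antisymm (by rwa [← h] at hLa) hL
      rw [← h, this]
      ring
    · rw [hε]
      field_simp
  have hbb : b / √b = √b := Real.div_sqrt
  have h1 : 1 ≤ √(r : ℝ) := by
    rw [Real.one_le_sqrt]
    exact_mod_cast hr
  have h2 : a + 2 * √b * L + (2 + 2 * ρ + 2 / √b) * (b * L)
      = a + 2 * b * (1 + ρ + 2 / √b) * L := by
    have : 2 / √b * b = 2 * √b := by rw [div_mul_eq_mul_div, mul_div_assoc, hbb]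
    linear_combination (-L) * this
  have h3 : 0 ≤ 2 * b * (1 + ρ + 2 / √b) * L := by positivity
  rw [h2, add_mul, one_mul, hεa]
  nlinarith [mul_le_mul_of_nonneg_right h1 h3]

end Nystrom

open Nystrom
theorem theorem3p1
    {Ω : Type*} [MeasurableSpace Ω] (μ : Measure Ω) [IsProbabilityMeasure μ]
    -- the dimensions; `p` is `c₁ r` and `s` is `c₂ r`
    (n r p s : ℕ) (c₁ c₂ : ℝ) (hr : 0 < r)
    (hc₁ : 1 < c₁) (hc₁₂ : c₁ < c₂) (hc₂ : c₂ < (n : ℝ) / (r : ℝ) - 1)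
    (hp : (p : ℝ) = c₁ * r) (hs : (s : ℝ) = c₂ * r)
    (hrp : r < p) (hpn : p < n) (hgap : 1 < (c₂ - c₁) * r)
    -- the symmetric matrix, its eigendecomposition and its best rank-`r` approximation
    (A V Ar : Matrix (Fin n) (Fin n) ℝ) (l : Fin n → ℝ)
    (hA : A.IsSymm) (hV : IsEigendecomposition A V l) (hAr : IsTruncatedSVD A r Ar)
    (lr lp : ℝ) (hlr : lr = l ⟨r - 1, by omega⟩) (hlp : lp = l ⟨p, hpn⟩) (hlr0 : lr ≠ 0)
    (L₂ : Matrix (Fin (p - r)) (Fin (p - r)) ℝ) (hL₂ : L₂ = diagBlock l r (p - r) (by omega))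
    (L₃ : Matrix (Fin (n - p)) (Fin (n - p)) ℝ) (hL₃ : L₃ = diagBlock l p (n - p) (by omega))
    -- the Gaussian sketch and its blocks
    (X : Ω → Matrix (Fin n) (Fin s) ℝ) (v : ℝ≥0) (hv : v ≠ 0) (hX : IsGaussianMatrix X v μ)
    (X₁ : Ω → Matrix (Fin r) (Fin s) ℝ)
    (hX₁ : ∀ ω, X₁ ω = (colBlock V 0 r (by omega))ᵀ * X ω)
    (X₂ : Ω → Matrix (Fin (p - r)) (Fin s) ℝ)
    (hX₂ : ∀ ω, X₂ ω = (colBlock V r (p - r) (by omega))ᵀ * X ω)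
    (X₃ : Ω → Matrix (Fin (n - p)) (Fin s) ℝ)
    (hX₃ : ∀ ω, X₃ ω = (colBlock V p (n - p) (by omega))ᵀ * X ω)
    -- the orthogonal complement, the matrix `B`, the thin QR decomposition and the projector
    (Q : Ω → Matrix (Fin s) (Fin (s - p + r)) ℝ)
    (hQ : ∀ᵐ ω ∂μ, IsOrthonormalComplement (X₂ ω)ᵀ (Q ω))
    (B : Ω → Matrix (Fin (n - p)) (Fin r) ℝ)
    (hB : ∀ ω, B ω = X₃ ω * Q ω * pinv (X₁ ω * Q ω))
    (Qh : Ω → Matrix (Fin (s - p + r)) (Fin r) ℝ) (Rh : Ω → Matrix (Fin r) (Fin r) ℝ)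
    (hQR : ∀ᵐ ω ∂μ, IsThinQR (pinv (X₁ ω * Q ω)) (Qh ω) (Rh ω))
    (U : Ω → Matrix (Fin s) (Fin r) ℝ) (hU : ∀ ω, U ω = Q ω * Qh ω)
    (P : Ω → Matrix (Fin s) (Fin s) ℝ) (hP : ∀ ω, P ω = U ω * (U ω)ᵀ)
    -- the Nyström error, the event (`L₃` is diagonal, so the map is `|Λ₃|^(1/2)`), the constants
    (E : Ω → Matrix (Fin n) (Fin n) ℝ)
    (hE : ∀ ω, E ω = A - A * X ω * pinv (P ω * (X ω)ᵀ * A * X ω * P ω) * (X ω)ᵀ * A)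
    (ΩF : Set Ω)
    (hΩF : ΩF = {ω | frobeniusNorm (L₃.map (fun x => √|x|) * B ω) ^ 2 ≤ 1 / 2 * |lr|})
    (b ε : ℝ) (hb : b = (r : ℝ) / ((c₂ - c₁) * r - 1))
    (hε : ε = 2 * b * √(r : ℝ) * (1 + |lp| / |lr| + 2 / √b)
      * (nuclearNorm L₃ / (nuclearNorm L₂ + nuclearNorm L₃))) :
    (∀ᵐ ω ∂μ, P ω * P ω = P ω ∧ (P ω)ᵀ = P ω ∧ (P ω).rank = r) ∧
    0 < μ ΩF ∧
    Integrable (fun ω => nuclearNorm (E ω)) μ[|ΩF] ∧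
    ∫ ω, nuclearNorm (E ω) ∂μ[|ΩF] ≤ (1 + ε) * nuclearNorm (A - Ar) := by
  have hcr : (c₂ - c₁) * r = (s : ℝ) - p := by rw [hs, hp]; ring
  -- Integrality upgrades `s - p > 1` to `s - p ≥ 2`, as the inverse moments require.
  have hps : p + 2 ≤ s := by
    rw [hcr] at hgap
    have h1 : (p : ℝ) + 1 < s := by linarith
    have h2 : p + 1 < s := by exact_mod_cast h1
    omega
  have hVV : V * Vᵀ = 1 := (Matrix.mem_orthogonalGroup_iff _ _).mp hV.orthogonal
  have hδ : 0 < |lr| := abs_pos.mpr hlr0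
  set L : ℝ := ∑ i : Fin n, if i.val < p then 0 else |l i| with hLdef
  set a : ℝ := ∑ i : Fin n, if i.val < r then 0 else |l i| with hadef
  have hL₃L : nuclearNorm L₃ = L := by rw [hL₃, nuclearNorm_tailBlock]
  have hL₂₃ : nuclearNorm L₂ + nuclearNorm L₃ = a := by
    rw [hL₂, hL₃, nuclearNorm_midBlock_add_tailBlock hrp.le]
  have hAAr : nuclearNorm (A - Ar) = a := nuclearNorm_sub_truncated hV hAr
  have hL0 : 0 ≤ L := Finset.sum_nonneg fun i _ => by split_ifs <;> positivity
  have hLa : L ≤ a := by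
    rw [← hL₃L, ← hL₂₃]
    have : 0 ≤ nuclearNorm L₂ := by
      rw [hL₂, nuclearNorm_diagBlock]
      exact Finset.sum_nonneg fun i _ => by split_ifs <;> positivity
    linarith
  have hsp : 0 < (s : ℝ) - p - 1 := by
    rw [hcr] at hgap
    linarith
  have hbs : b = r / ((s : ℝ) - p - 1) := by rw [hb, hcr]
  have hb0 : 0 < b := by
    rw [hbs]
    positivity
  -- the law of the sketch in the eigenbasis
  obtain ⟨hYm, hYlaw⟩ := hX.law_orthogonal_mul hVV
  set Y : Ω → Fin n → Fin s → ℝ := fun ω i j => (Vᵀ * X ω) i j with hY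
  set K : Ω → Matrix (Fin n) (Fin r) ℝ := fun ω => sketchCoeff hrp.le hpn.le (Y ω) with hK
  set y : Ω → ℝ := fun ω => tailEnergy p l (K ω) with hy
  have hdet : ∀ᵐ ω ∂μ, IsUnit (head p hpn.le (Y ω) * (head p hpn.le (Y ω))ᵀ).det := by
    have h1 := ae_isUnit_det_head (n := n) hv hpn.le hps
    rw [← hYlaw] at h1
    exact ae_of_ae_map hYm h1
  have hpinv : ∀ᵐ ω ∂μ, Q ω * pinv (X₁ ω * Q ω) = dualFrame r hrp.le (head p hpn.le (Y ω)) := by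
    filter_upwards [hdet, hQ] with ω hω hQω
    refine (mul_pinv_eq_dualFrame hrp.le hω (fun i => ?_) (fun k => ?_) hQω).1
    · rw [hX₁]
      have : blockIdx 0 r (by omega) i = Fin.castLE hpn.le (Fin.castLE hrp.le i) :=
        Fin.ext (Nat.zero_add _)
      ext j
      simp only [Matrix.mul_apply, transpose_apply, colBlock, submatrix_apply, this, head, of_apply,
        hY, id]
    · rw [hX₂]
      rfl
  have hUF : ∀ᵐ ω ∂μ, (U ω)ᵀ * U ω = 1 ∧
      dualFrame r hrp.le (head p hpn.le (Y ω)) = U ω * Rh ω := by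
    filter_upwards [hpinv, hQ, hQR] with ω h1 h2 h3
    rw [hU, ← h1]
    exact thinQR_factor h2.orthonormal h3
  have hKB : ∀ᵐ ω ∂μ, frobeniusNorm (L₃.map (fun x => √|x|) * B ω) ^ 2 = y ω := by
    filter_upwards [hpinv] with ω h1
    have : B ω = (K ω).submatrix (blockIdx p (n - p) (by omega)) id := by
      rw [hB, Matrix.mul_assoc, h1, hX₃]
      rfl
    rw [this, hL₃, frobeniusNorm_tail_sq]
  -- the event
  have hym : AEMeasurable y μ := (measurable_tailEnergy hrp.le hpn.le l).comp_aemeasurable hYm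
  have hΩiff : ∀ᵐ ω ∂μ, ω ∈ ΩF ↔ y ω ≤ 1 / 2 * |lr| := by
    filter_upwards [hKB] with ω h1
    rw [hΩF, Set.mem_ofPred_eq, h1]
  have hΩae : ΩF =ᵐ[μ] {ω | y ω ≤ 1 / 2 * |lr|} := by
    filter_upwards [hΩiff] with ω h1
    exact propext h1
  -- `Q`, `Qh` and `B` are arbitrary choices, not assumed measurable; but `B` agrees almost surely
  -- with a measurable function of `Y`, so null measurability is available.
  have hΩnull : NullMeasurableSet ΩF μ :=
    (nullMeasurableSet_le hym aemeasurable_const).congr hΩae.symm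
  have hΩpos : 0 < μ ΩF := by
    rw [measure_congr hΩae]
    have h1 := gaussianRows_tailEnergy_le_pos (n := n) hv hrp.le hpn.le (by omega : p ≤ s) l
      (by positivity : 0 < 1 / 2 * |lr|)
    rw [← hYlaw, Measure.map_apply_of_aemeasurable hYm
      (measurableSet_le (measurable_tailEnergy hrp.le hpn.le l) measurable_const)] at h1
    exact h1
  -- the mean of the tail energy
  have hy0 : ∀ ω, 0 ≤ y ω := fun ω => tailEnergy_nonneg l (K ω)
  have hlint : ∫⁻ ω, ENNReal.ofReal (y ω) ∂μ ≤ ENNReal.ofReal (b * L) := by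
    have h1 := lintegral_tailEnergy_le (n := n) hv hrp.le hpn.le hps l
    rw [← hYlaw, lintegral_map' (measurable_tailEnergy hrp.le hpn.le l).ennreal_ofReal.aemeasurable
      hYm, ← hbs] at h1
    exact h1
  have hyint : Integrable y μ := by
    refine ⟨hym.aestronglyMeasurable, ?_⟩
    rw [hasFiniteIntegral_iff_ofReal (ae_of_all _ hy0)]
    exact hlint.trans_lt ENNReal.ofReal_lt_top
  have hymean : ∫ ω, y ω ∂μ ≤ b * L := by
    rw [integral_eq_lintegral_of_nonneg_ae (ae_of_all _ hy0) hym.aestronglyMeasurable]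
    exact ENNReal.toReal_le_of_le_ofReal (by positivity) hlint
  have hycond : ∫ ω, y ω ∂μ[|ΩF] ≤ b * L := by
    refine (integral_cond_le_integral hyint hΩnull hΩpos (t := 1 / 2 * |lr|) ?_ ?_).trans hymean
    · filter_upwards [hΩiff] with ω h1 h2 using h1.mp h2
    · filter_upwards [hΩiff] with ω h1 h2
      exact (not_le.mp fun h => h2 (h1.mpr h)).le
  have : IsProbabilityMeasure μ[|ΩF] := cond_isProbabilityMeasure hΩpos.ne'
  have hac : μ[|ΩF] ≪ μ := cond_absolutelyContinuous
  have hmem : ∀ᵐ ω ∂μ[|ΩF], ω ∈ ΩF := ae_cond_mem₀ hΩnull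
  have hyint' : Integrable y μ[|ΩF] := by
    unfold ProbabilityTheory.cond
    exact hyint.restrict.smul_measure (ENNReal.inv_ne_top.mpr hΩpos.ne')
  -- the pointwise bound
  set ρ : ℝ := |lp| / |lr| with hρ
  set g : Ω → ℝ := fun ω => a + 2 * √b * L + (2 + 2 * ρ + 2 / √b) * y ω with hg
  have hbound : ∀ᵐ ω ∂μ[|ΩF], nuclearNorm (E ω) = nuclearNorm (sketchError l (K ω)) ∧
      nuclearNorm (E ω) ≤ g ω := by
    filter_upwards [hmem, hac.ae_le hdet, hac.ae_le hUF, hac.ae_le hΩiff] with ω h1 h2 h3 h4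
    have hyω : tailEnergy p l (K ω) ≤ |lr| / 2 := by
      have := h4.mp h1
      linarith
    obtain ⟨hunit, hle⟩ := nuclearNorm_sketch_error_le hrp.le hpn.le hδ
      (fun i hi => by
        rw [hlr]
        exact hV.antitone (Fin.le_def.mpr (by simp only; omega)))
      (abs_nonneg lp)
      (fun i hi => by
        rw [hlp]
        exact hV.antitone (Fin.le_def.mpr hi))
      (fun i c hi => sketchCoeff_apply_head hrp.le hpn.le h2 i c hi) hyω
    have hEω : E ω = V * sketchError l (K ω) * Vᵀ := by
      rw [hE, hP]
      exact nystrom_error_eq hV.eq h3.1 h3.2 rfl hunit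
    have heq : nuclearNorm (E ω) = nuclearNorm (sketchError l (K ω)) := by
      rw [hEω, nuclearNorm_orthogonal_conj hVV]
    refine ⟨heq, ?_⟩
    rw [heq]
    refine hle.trans ?_
    have hsb : 0 < √b := Real.sqrt_pos.mpr hb0
    -- The weight `√b` balances the two terms when `y` equals its mean bound `bL`.
    have hamgm : 4 * √L * √(y ω) ≤ 2 * √b * L + 2 / √b * y ω := by
      have e1 : √L * √L = L := Real.mul_self_sqrt hL0
      have e2 : √(y ω) * √(y ω) = y ω := Real.mul_self_sqrt (hy0 ω)
      have e3 : 2 * √b * L + 2 / √b * y ω - 4 * √L * √(y ω)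
          = 2 / √b * (√b * √L - √(y ω)) ^ 2 := by
        rw [← e1, ← e2]
        simp only [Real.sqrt_mul_self (Real.sqrt_nonneg _)]
        field_simp
        ring
      have e4 : 0 ≤ 2 / √b * (√b * √L - √(y ω)) ^ 2 := by positivity
      linarith
    simp only [hg, hρ]
    have hyeq : tailEnergy p l (K ω) = y ω := rfl
    rw [hyeq, ← hLdef, ← hadef]
    linarith
  have hgint : Integrable g μ[|ΩF] := (integrable_const _).add (hyint'.const_mul _)
  have hEm : AEStronglyMeasurable (fun ω => nuclearNorm (E ω)) μ[|ΩF] := by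
    have h1 : AEMeasurable (fun ω => nuclearNorm (sketchError l (K ω))) μ :=
      (measurable_nuclearNorm_sketchError l
        (measurable_sketchCoeff (s := s) hrp.le hpn.le)).comp_aemeasurable hYm
    refine ((h1.mono_ac hac).congr ?_).aestronglyMeasurable
    filter_upwards [hbound] with ω hω using hω.1.symm
  have hEint : Integrable (fun ω => nuclearNorm (E ω)) μ[|ΩF] := by
    refine hgint.mono' hEm ?_
    filter_upwards [hbound] with ω hω
    rw [Real.norm_eq_abs, abs_of_nonneg (nuclearNorm_nonneg _)]
    exact hω.2
  refine ⟨?_, hΩpos, hEint, ?_⟩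
  · filter_upwards [hUF] with ω hω
    rw [hP]
    exact projector_of_orthonormal hω.1
  · have hρ0 : 0 ≤ ρ := by positivity
    calc ∫ ω, nuclearNorm (E ω) ∂μ[|ΩF] ≤ ∫ ω, g ω ∂μ[|ΩF] := by
          refine integral_mono_ae hEint hgint ?_
          filter_upwards [hbound] with ω hω using hω.2
      _ = a + 2 * √b * L + (2 + 2 * ρ + 2 / √b) * ∫ ω, y ω ∂μ[|ΩF] := by
          simp only [hg]
          rw [integral_add (integrable_const _) (hyint'.const_mul _), integral_const_mul]
          simp
      _ ≤ a + 2 * √b * L + (2 + 2 * ρ + 2 / √b) * (b * L) := by gcongr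
      _ ≤ (1 + ε) * nuclearNorm (A - Ar) := by
          rw [hAAr]
          refine error_constant_le hr hL0 hLa hρ0 hb0 ?_
          rw [hε, hL₂₃, hL₃L]
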